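/- Let $\mathcal M\subseteq B(H)$ be a properly infinite $\sigma$-finite von Neumann algebra with centre $\mathcal Z(\mathcal M)$, and let $\alpha=(\alpha(1),\dots,\alpha(n))\in\mathcal M^n$ be a tuple of pairwise commuting self-adjoint operators with joint spectral measure $e^\alpha$. For $S\subseteq\mathcal M$ let $C^*(S)$ be the $C^*$-algebra generated by $S$ and $\mathbf 1$, let $WZ^*(\alpha)$ be the von Neumann algebra generated by $\alpha$ and $\mathcal Z(\mathcal M)$, and let $\mathcal P_f(\mathcal M)$ be the set of finite projections of $\mathcal M$. Write $p\sim q$ for Murray--von Neumann equivalence in $\mathcal M$ and $c(p)$ for the central support of $p$. Assume that $WZ^*(\alpha)\cap\mathcal P_f(\mathcal M)=\{0\}$. Put $$G=\Big\{e^\alpha\Big(\prod_{j=1}^n\Big[\tfrac{k_j}{2^m},\tfrac{k_j+1}{2^m}\Big)\Big): m\in\mathbb Z_+,\ k\in\mathbb Z^n\Big\},\qquad Z=\{c(p):p\in G\},\qquad \mathcal A=C^*(G\cup Z).$$ (1) There is a sequence of unital $*$-homomorphisms $\psi_k:\mathcal A\to\mathcal Z(\mathcal M)$, $k\in\mathbb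 N$, such that (a) $\psi_k(b)=b$ for all $b\in C^*(Z)$ and all $k$; (b) for every $0\ne a\in\mathcal A$ there is $k$ with $\psi_k(a)\neq0$; (c) $p\le\bigvee_k\psi_k(p)$ for every $p\in G$. There is also a sequence $(p_k)_{k\in\mathbb N}$ of pairwise orthogonal projections in $\mathcal M$ with $p_k\sim\mathbf 1$ for all $k$ and $\sum_kp_k=\mathbf 1$ in the strong operator topology. (2) For all sequences $(\psi_k)$ and $(p_k)$ as in (1), the series $\psi(a)=\sum_{k}\psi_k(a)p_k$ converges in the strong operator topology for every $a\in\mathcal A$ and defines a unital $*$-homomorphism $\psi:\mathcal A\to\mathcal M$, and (i) $\psi$ is faithful (injective); (ii) $C^*(\alpha)\subseteq\mathcal A$, and $\psi|_{C^*(\alpha)}$ is approximately unitarily equivalent in $\mathcal M$ to the identity of $C^*(\alpha)$: there is a sequence of unitaries $u_m\in\mathcal M$ such that $\|\psi(a)-u_m^{-1}au_m\|\to0$ for every $a\in C^*(\alpha)$. -/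

import Mathlib

open Filter Topology

noncomputable section

namespace VNApprox

variable {H : Type*} [NormedAddCommGroup H] [InnerProductSpace ℂ H] [CompleteSpace H]

/-! ### Projections of a von Neumann algebra -/

/-- The centre `Z(M) = M ∩ M'`. -/
def centre (M : VonNeumannAlgebra H) : StarSubalgebra ℂ (H →L[ℂ] H) :=
  M.toStarSubalgebra ⊓ M.commutant.toStarSubalgebra

/-- The set `P(M)` of all (self-adjoint) projections in `M`. -/
def projections (M : VonNeumannAlgebra H) : Set (H →L[ℂ] H) :=
  {p | p ∈ M ∧ IsStarProjection p}

/-- The set `P(Z(M))` of all central projections of `M`. -/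
def centralProjections (M : VonNeumannAlgebra H) : Set (H →L[ℂ] H) :=
  {z | z ∈ centre M ∧ IsStarProjection z}

/-- Murray-von Neumann equivalence `p ∼ q` in `M`. -/
def MvNEquiv (M : VonNeumannAlgebra H) (p q : H →L[ℂ] H) : Prop :=
  ∃ v ∈ M, star v * v = p ∧ v * star v = q

/-- The set `P_f(M)` of all finite projections in `M`: `p ∼ q ≤ p` implies `p = q`. -/
def finiteProjections (M : VonNeumannAlgebra H) : Set (H →L[ℂ] H) :=
  {p | p ∈ projections M ∧ ∀ q ∈ projections M, MvNEquiv M p q → q ≤ p → p = q}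

/-- A projection `p` in `M` is properly infinite if `z p` is infinite for every central
projection `z` with `z p ≠ 0`. -/
def IsProperlyInfiniteProjection (M : VonNeumannAlgebra H) (p : H →L[ℂ] H) : Prop :=
  p ∈ projections M ∧ ∀ z ∈ centralProjections M, z * p ≠ 0 → z * p ∉ finiteProjections M

/-- `M` is properly infinite if its identity is. -/
def IsProperlyInfinite (M : VonNeumannAlgebra H) : Prop :=
  IsProperlyInfiniteProjection M 1

/-- `M` is σ-finite: every orthogonal family of non-zero projections in `M` is countable. -/
def IsSigmaFinite (M : VonNeumannAlgebra H) : Prop :=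
  ∀ S : Set (H →L[ℂ] H), (∀ p ∈ S, p ∈ projections M ∧ p ≠ 0) →
    S.Pairwise (fun p q => p * q = 0) → S.Countable

/-- The supremum of a set of projections: the projection onto the closed linear span of their
ranges. -/
def projSup (S : Set (H →L[ℂ] H)) : H →L[ℂ] H :=
  (⨆ p ∈ S, LinearMap.range (p : H →ₗ[ℂ] H)).topologicalClosure.starProjection

/-- The infimum of a set of projections: the projection onto the intersection of their ranges
(this intersection is closed already; the closure only serves to find the projection). -/
def projInf (S : Set (H →L[ℂ] H)) : H →L[ℂ] H :=
  (⨅ p ∈ S, LinearMap.range (p : H →ₗ[ℂ] H)).topologicalClosure.starProjection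

/-- The central support `c(a)`: the infimum of all central projections `z` with `z a = a`. -/
def centralSupport (M : VonNeumannAlgebra H) (a : H →L[ℂ] H) : H →L[ℂ] H :=
  projInf {z | z ∈ centralProjections M ∧ z * a = a}

/-! ### Generated algebras -/

/-- `C*(S)`: the unital C*-algebra generated by `S` (norm closure of the unital *-algebra). -/
def cstarGen (S : Set (H →L[ℂ] H)) : StarSubalgebra ℂ (H →L[ℂ] H) :=
  (StarAlgebra.adjoin ℂ S).topologicalClosure

/-- `W*(S)`: the von Neumann algebra generated by `S`, as the smallest one containing `S`. -/
def wstarGen (S : Set (H →L[ℂ] H)) : Set (H →L[ℂ] H) :=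
  {x | ∀ N : VonNeumannAlgebra H, S ⊆ (N : Set (H →L[ℂ] H)) → x ∈ N}

/-- `WZ*(S)`: the von Neumann algebra generated by `W*(S)` and the centre of `M`. -/
def wzstarGen (M : VonNeumannAlgebra H) (S : Set (H →L[ℂ] H)) : Set (H →L[ℂ] H) :=
  wstarGen (wstarGen S ∪ (centre M : Set (H →L[ℂ] H)))

/-! ### Spectral projections -/

/-- The left support of `x`: the projection onto the closure of the range of `x`. -/
def leftSupport (x : H →L[ℂ] H) : H →L[ℂ] H :=
  (LinearMap.range (x : H →ₗ[ℂ] H)).topologicalClosure.starProjection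

/-- The spectral family of a self-adjoint operator `x`, in its left-continuous version: the
spectral projection `e^x((-∞, t))`, which is the support of the positive part of `t - x`. -/
def spectralBelow (x : H →L[ℂ] H) (t : ℝ) : H →L[ℂ] H :=
  leftSupport ((algebraMap ℝ (H →L[ℂ] H) t - x)⁺)

/-- The spectral projection `e^x([a, b))` of a self-adjoint operator `x`, for `a ≤ b`. -/
def spectralIco (x : H →L[ℂ] H) (a b : ℝ) : H →L[ℂ] H :=
  spectralBelow x b - spectralBelow x a

/-- The value on the box `[a₁, b₁) × ⋯ × [aₙ, bₙ)` of the joint spectral measure `e^α` of a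
commuting self-adjoint tuple `α`: the joint spectral measure is the product of the spectral
measures of the entries, so this is the product of the (commuting) projections
`e^{α(j)}([aⱼ, bⱼ))`. -/
def spectralBox {n : ℕ} (α : Fin n → H →L[ℂ] H) (a b : Fin n → ℝ) : H →L[ℂ] H :=
  (List.ofFn fun j => spectralIco (α j) (a j) (b j)).prod

/-- The set `G` of all spectral projections `e^α(U)`, where `U` runs over the dyadic cubes
`∏ⱼ [kⱼ / 2^m, (kⱼ + 1) / 2^m)` with `m ≥ 0` and `k ∈ ℤⁿ`. -/
def dyadicProjections {n : ℕ} (α : Fin n → H →L[ℂ] H) : Set (H →L[ℂ] H) :=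
  {e | ∃ (m : ℕ) (k : Fin n → ℤ),
    e = spectralBox α (fun j => (k j : ℝ) / 2 ^ m) (fun j => ((k j : ℝ) + 1) / 2 ^ m)}

/-- The set `Z = {c(p) : p ∈ G}`. -/
def dyadicCentralSupports (M : VonNeumannAlgebra H) {n : ℕ} (α : Fin n → H →L[ℂ] H) :
    Set (H →L[ℂ] H) :=
  centralSupport M '' dyadicProjections α

/-- The C*-algebra `A = C*(G ∪ Z)`. -/
def dyadicAlgebra (M : VonNeumannAlgebra H) {n : ℕ} (α : Fin n → H →L[ℂ] H) :
    StarSubalgebra ℂ (H →L[ℂ] H) :=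
  cstarGen (dyadicProjections α ∪ dyadicCentralSupports M α)

/-! ### The ingredients of the homomorphism `ψ` -/

/-- A sequence of centre-valued *-homomorphisms `ψ_k` on `A = C*(G ∪ Z)` such that
each `ψ_k` is the identity on `C*(Z)`, the sequence separates the points of `A`, and
`p ≤ ⋁ₖ ψ_k(p)` for all `p ∈ G`. -/
structure IsSeparatingFamily (M : VonNeumannAlgebra H) {n : ℕ} (α : Fin n → H →L[ℂ] H)
    (ψ : ℕ → (dyadicAlgebra M α →⋆ₐ[ℂ] centre M)) : Prop where
  eq_self : ∀ (k : ℕ) (b : dyadicAlgebra M α),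
    (b : H →L[ℂ] H) ∈ cstarGen (dyadicCentralSupports M α) →
      (ψ k b : H →L[ℂ] H) = (b : H →L[ℂ] H)
  separating : ∀ a : dyadicAlgebra M α, a ≠ 0 → ∃ k, ψ k a ≠ 0
  le_sup : ∀ p : dyadicAlgebra M α, (p : H →L[ℂ] H) ∈ dyadicProjections α →
    (p : H →L[ℂ] H) ≤ projSup (Set.range fun k => (ψ k p : H →L[ℂ] H))

/-- A sequence of pairwise orthogonal projections `p_k ∼ 1` in `M` with `∑ₖ p_k = 1` in the
strong operator topology. -/
structure IsEquivPartition (M : VonNeumannAlgebra H) (p : ℕ → H →L[ℂ] H) : Prop where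
  mem : ∀ k, p k ∈ projections M
  orthogonal : Pairwise fun k l => p k * p l = 0
  equiv_one : ∀ k, MvNEquiv M (p k) 1
  hasSum_one : ∀ x : H, HasSum (fun k => p k x) x

/-- Approximate (unitary) equivalence in `M` of two unital *-homomorphisms `φ, ρ : B → M`: there
are unitaries `u_m` in `M` with `φ(b) = lim u_m⁻¹ ρ(b) u_m` in norm for all `b`. -/
def ApproxEquiv (M : VonNeumannAlgebra H) {B : Type*} [Ring B] [StarRing B] [Algebra ℂ B]
    (φ ρ : B →⋆ₐ[ℂ] M.toStarSubalgebra) : Prop :=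
  ∃ u : ℕ → unitary (H →L[ℂ] H), (∀ m, (u m : H →L[ℂ] H) ∈ M) ∧
    ∀ b : B, Tendsto
      (fun m => ((u m)⁻¹ : unitary (H →L[ℂ] H)) * (ρ b : H →L[ℂ] H) * (u m : H →L[ℂ] H))
      atTop (𝓝 (φ b : H →L[ℂ] H))

end VNApprox

end

/-!
# Approximate diagonalisation of commuting self-adjoint tuples

**The retractions `ψ_k`.** Let `q` be a projection commuting with the countable commuting family
`g₁, g₂, …` of projections that generates the algebra. Starting from `f = 1`, replace `f`
successively by `f g + (1 - c(f g)) f`, for `g = q, g₁, g₂, …`. All these projections have central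
support `1`, so cutting the centre by them is isometric, and on the new one `g` agrees with the
central projection `c(f g)` (`exists_full_sequence`). Hence every element of the generated
C*-algebra is asymptotically equal, along the decreasing sequence of the `f`'s, to a unique
central element, and assigning it is a `*`-homomorphism that fixes central elements and sends `q`
to `c(q)` (`exists_retraction`). It remains to let `q` run over the countably many cells, products
of `g_i` or `1 - g_i`. If `a ≠ 0`, halving cells while keeping `‖a q‖ = ‖a‖` yields cells on which
`a` is close to a scalar of modulus at least `‖a‖`, so the retraction of such a cell does not kill
`a` (`exists_cellProjection`, `exists_separating_retractions`).

**Comparison.** Call a projection stable if it dominates countably many orthogonal copies of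
itself. In a σ-finite algebra a stable projection absorbs every projection under its central
support (`subequiv_of_isStable`): a maximal orthogonal family of subprojections that fit into it
is countable, so its members can be moved into different copies. By Schröder-Bernstein, stable
projections with the same central support are equivalent (`mvnEquiv_of_isStable`). An infinite
projection dominates a stable one, the sum of an orbit under a proper isometry; so a maximal
family shows that properly infinite projections are stable (`isStable_of_isProperlyInfinite`). In
particular `1` is stable, which gives the partition `(p_k)`.

**Approximate equivalence.** For a dyadic box `e ∈ G`, the assumption on `WZ*(α)` makes `e`
properly infinite, hence stable, and `ψ(e) = ∑ ψ_k(e) p_k` is stable as a sum of central cuts of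
stable projections. Both have central support `c(e)`: `ψ_k(e) ≤ ψ_k(c(e)) = c(e)`, and
`e ≤ ⋁ ψ_k(e)`. So `e ∼ ψ(e)` (`mvnEquiv_diagonal`). Finitely many boxes of level `m` have sum
`1`, as `α` is bounded; adding up partial isometries gives a unitary `u ∈ M` with `e u = u ψ(e)`
for all of them. As each `α j` is within `2⁻ᵐ` of a combination of these boxes
(`exists_dyadic_partition`), `u⁻¹ (α j) u` is within `2 · 2⁻ᵐ` of `ψ(α j)`, and convergence
passes from the generators to `C*(α)`.
-/

noncomputable section

set_option linter.unusedSectionVars false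

namespace VNApprox

variable {H : Type*} [NormedAddCommGroup H] [InnerProductSpace ℂ H] [CompleteSpace H]

/-! ### Supports and central supports -/

theorem isClosed_vonNeumannAlgebra (M : VonNeumannAlgebra H) :
    IsClosed (M : Set (H →L[ℂ] H)) := by
  rw [← M.centralizer_centralizer]
  exact Set.isClosed_centralizer _

theorem mem_centre_iff {M : VonNeumannAlgebra H} {z : H →L[ℂ] H} :
    z ∈ centre M ↔ z ∈ M ∧ z ∈ M.commutant := Iff.rfl

theorem isClosed_centre (M : VonNeumannAlgebra H) : IsClosed (centre M : Set (H →L[ℂ] H)) :=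
  (isClosed_vonNeumannAlgebra M).inter (isClosed_vonNeumannAlgebra M.commutant)

theorem commute_of_mem_centre {M : VonNeumannAlgebra H} {z x : H →L[ℂ] H} (hz : z ∈ centre M)
    (hx : x ∈ M) : Commute z x :=
  (VonNeumannAlgebra.mem_commutant_iff.1 (mem_centre_iff.1 hz).2 x hx).symm

/-- Membership in a von Neumann algebra through the double commutant. -/
theorem mem_of_forall_commute {M : VonNeumannAlgebra H} {x : H →L[ℂ] H}
    (h : ∀ y ∈ M.commutant, Commute y x) : x ∈ M := by
  rw [← M.commutant_commutant]
  exact VonNeumannAlgebra.mem_commutant_iff.2 h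

theorem commute_of_mem_commutant {M : VonNeumannAlgebra H} {x y : H →L[ℂ] H}
    (hy : y ∈ M.commutant) (hx : x ∈ M) : Commute y x :=
  (VonNeumannAlgebra.mem_commutant_iff.1 hy x hx).symm

theorem projSub_mul {p q : H →L[ℂ] H} (hp : IsStarProjection p) (hq : IsStarProjection q)
    (h : p * q = q) : q * p = q := by
  have := congrArg star h
  rwa [star_mul, hp.isSelfAdjoint.star_eq, hq.isSelfAdjoint.star_eq] at this

theorem orth_symm {p q : H →L[ℂ] H} (hp : IsStarProjection p) (hq : IsStarProjection q)
    (h : p * q = 0) : q * p = 0 := by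
  have := congrArg star h
  rwa [star_mul, hp.isSelfAdjoint.star_eq, hq.isSelfAdjoint.star_eq, star_zero] at this

theorem isStarProjection_mul {p q : H →L[ℂ] H} (hp : IsStarProjection p)
    (hq : IsStarProjection q) (h : Commute p q) : IsStarProjection (p * q) where
  isIdempotentElem := hp.isIdempotentElem.mul_of_commute h hq.isIdempotentElem
  isSelfAdjoint := (hp.isSelfAdjoint.commute_iff hq.isSelfAdjoint).1 h

theorem isStarProjection_sub {p q : H →L[ℂ] H} (hp : IsStarProjection p)
    (hq : IsStarProjection q) (h : q * p = p) : IsStarProjection (q - p) where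
  isIdempotentElem := by
    have h' := projSub_mul hq hp h
    have h1 := hp.isIdempotentElem.eq
    have h2 := hq.isIdempotentElem.eq
    simp only [IsIdempotentElem, sub_mul, mul_sub, h, h', h1, h2]
    abel
  isSelfAdjoint := hq.isSelfAdjoint.sub hp.isSelfAdjoint

theorem isStarProjection_add {p q : H →L[ℂ] H} (hp : IsStarProjection p)
    (hq : IsStarProjection q) (h : p * q = 0) : IsStarProjection (p + q) where
  isIdempotentElem := by
    simp only [IsIdempotentElem, add_mul, mul_add, h, orth_symm hp hq h,
      hp.isIdempotentElem.eq, hq.isIdempotentElem.eq]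
    abel
  isSelfAdjoint := hp.isSelfAdjoint.add hq.isSelfAdjoint

/-- The projection onto a closed subspace invariant under the commutant of `M` lies in `M`. -/
theorem starProjection_mem {M : VonNeumannAlgebra H} (K : Submodule ℂ H)
    [K.HasOrthogonalProjection] (h : ∀ y ∈ M.commutant, ∀ x ∈ K, y x ∈ K) :
    K.starProjection ∈ M := by
  rw [VonNeumannAlgebra.IsStarProjection.mem_iff isStarProjection_starProjection]
  intro y hy
  rw [Submodule.range_starProjection]
  exact fun x hx => h y hy x hx

theorem closure_invariant {K : Submodule ℂ H} {y : H →L[ℂ] H} (h : ∀ x ∈ K, y x ∈ K) :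
    ∀ x ∈ K.topologicalClosure, y x ∈ K.topologicalClosure :=
  Submodule.topologicalClosure_mem_invtSubmodule (f := y) (s := K) h

theorem isStarProjection_leftSupport (x : H →L[ℂ] H) : IsStarProjection (leftSupport x) :=
  isStarProjection_starProjection

theorem leftSupport_mul (x : H →L[ℂ] H) : leftSupport x * x = x := by
  ext ξ
  exact Submodule.starProjection_eq_self_iff.2
    (Submodule.le_topologicalClosure _ (LinearMap.mem_range_self _ ξ))

/-- A bounded operator that vanishes on a subspace kills the projection onto its closure. -/
theorem mul_starProjection_closure_eq_zero {K : Submodule ℂ H} {y : H →L[ℂ] H}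
    (h : ∀ x ∈ K, y x = 0) : y * K.topologicalClosure.starProjection = 0 := by
  have hle : K.topologicalClosure ≤ LinearMap.ker (y : H →ₗ[ℂ] H) :=
    Submodule.topologicalClosure_minimal _ h (ContinuousLinearMap.isClosed_ker y)
  ext ξ
  exact hle (Submodule.starProjection_apply_mem _ ξ)

theorem mul_leftSupport_eq_zero {x y : H →L[ℂ] H} (h : y * x = 0) : y * leftSupport x = 0 := by
  refine mul_starProjection_closure_eq_zero ?_
  rintro _ ⟨ξ, rfl⟩
  exact congrArg (fun T : H →L[ℂ] H => T ξ) h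

theorem leftSupport_mem {M : VonNeumannAlgebra H} {x : H →L[ℂ] H} (hx : x ∈ M) :
    leftSupport x ∈ M := by
  refine starProjection_mem _ fun y hy => closure_invariant ?_
  rintro _ ⟨ξ, rfl⟩
  exact ⟨y ξ, congrArg (fun T : H →L[ℂ] H => T ξ) (commute_of_mem_commutant hy hx).symm.eq⟩

/-- An absorbing projection dominates the left support. -/
theorem mul_leftSupport_of_mul {p x : H →L[ℂ] H} (h : p * x = x) :
    p * leftSupport x = leftSupport x := by
  have : (1 - p) * leftSupport x = 0 := mul_leftSupport_eq_zero (by rw [sub_mul, h]; simp)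
  rw [sub_mul, one_mul, sub_eq_zero] at this
  exact this.symm

theorem commute_leftSupport {x y : H →L[ℂ] H} (h : Commute y x) (h' : Commute (star y) x) :
    Commute y (leftSupport x) := by
  have key : ∀ w : H →L[ℂ] H, Commute w x →
      leftSupport x * (w * leftSupport x) = w * leftSupport x := by
    intro w hw
    have : (1 - leftSupport x) * w * leftSupport x = 0 := by
      apply mul_leftSupport_eq_zero
      rw [mul_assoc, hw.eq, sub_mul, ← mul_assoc (leftSupport x), leftSupport_mul]
      simp
    rw [sub_mul, sub_mul, one_mul, sub_eq_zero] at this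
    rw [← mul_assoc, ← this]
  have h1 := key y h
  have h2 := congrArg star (key _ h')
  have hs := (isStarProjection_leftSupport x).isSelfAdjoint.star_eq
  simp only [star_mul, star_star, hs] at h2
  rw [Commute, SemiconjBy, ← h1, ← mul_assoc, h2]

theorem isStarProjection_centralSupport (M : VonNeumannAlgebra H) (a : H →L[ℂ] H) :
    IsStarProjection (centralSupport M a) :=
  isStarProjection_starProjection

theorem range_eq_of_isStarProjection {z : H →L[ℂ] H} (hz : IsStarProjection z) {x : H} :
    x ∈ LinearMap.range (z : H →ₗ[ℂ] H) ↔ z x = x :=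
  ⟨by rintro ⟨y, rfl⟩
      exact congrArg (fun T : H →L[ℂ] H => T y) hz.isIdempotentElem.eq, fun h => ⟨x, h⟩⟩

theorem centralSupport_mem_centre (M : VonNeumannAlgebra H) (a : H →L[ℂ] H) :
    centralSupport M a ∈ centre M := by
  have key : ∀ y : H →L[ℂ] H, (∀ z ∈ centre M, Commute y z) → ∀ x ∈
      (⨅ p ∈ {z | z ∈ centralProjections M ∧ z * a = a},
        LinearMap.range (p : H →ₗ[ℂ] H)).topologicalClosure, y x ∈
      (⨅ p ∈ {z | z ∈ centralProjections M ∧ z * a = a},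
        LinearMap.range (p : H →ₗ[ℂ] H)).topologicalClosure := by
    intro y hy
    refine closure_invariant fun x hx => ?_
    simp only [Submodule.mem_iInf] at hx ⊢
    intro z hz
    have h1 := (range_eq_of_isStarProjection hz.1.2).1 (hx z hz)
    have h2 := congrArg (fun T : H →L[ℂ] H => T x) (hy z hz.1.1).eq
    simp only [mul_apply_eq_comp, h1] at h2
    exact (range_eq_of_isStarProjection hz.1.2).2 h2.symm
  refine mem_centre_iff.2 ⟨starProjection_mem _ fun y hy => key y ?_,
    starProjection_mem _ fun y hy => key y ?_⟩
  · exact fun z hz => commute_of_mem_commutant hy hz.1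
  · rw [M.commutant_commutant] at hy
    exact fun z hz => (commute_of_mem_centre hz hy).symm

theorem centralSupport_mul (M : VonNeumannAlgebra H) (a : H →L[ℂ] H) :
    centralSupport M a * a = a := by
  ext ξ
  refine Submodule.starProjection_eq_self_iff.2 (Submodule.le_topologicalClosure _ ?_)
  simp only [Submodule.mem_iInf]
  intro z hz
  exact (range_eq_of_isStarProjection hz.1.2).2 (congrArg (fun T : H →L[ℂ] H => T ξ) hz.2)

theorem mul_centralSupport_of_mul {M : VonNeumannAlgebra H} {a z : H →L[ℂ] H}
    (hz : z ∈ centre M) (hp : IsStarProjection z) (h : z * a = a) :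
    z * centralSupport M a = centralSupport M a := by
  have hle : (⨅ p ∈ {z | z ∈ centralProjections M ∧ z * a = a},
        LinearMap.range (p : H →ₗ[ℂ] H)) ≤ LinearMap.range (z : H →ₗ[ℂ] H) :=
    iInf₂_le (f := fun (p : H →L[ℂ] H) (_ : p ∈ {z | z ∈ centralProjections M ∧ z * a = a}) =>
      LinearMap.range (p : H →ₗ[ℂ] H)) z ⟨⟨hz, hp⟩, h⟩
  have : (1 - z) * centralSupport M a = 0 := by
    refine mul_starProjection_closure_eq_zero fun x hx => ?_
    have := (range_eq_of_isStarProjection hp).1 (hle hx)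
    simp [this]
  rw [sub_mul, one_mul, sub_eq_zero] at this
  exact this.symm

theorem leftSupport_mem_centre {M : VonNeumannAlgebra H} {x : H →L[ℂ] H} (hx : x ∈ centre M) :
    leftSupport x ∈ centre M :=
  mem_centre_iff.2 ⟨leftSupport_mem hx.1, leftSupport_mem (M := M.commutant) hx.2⟩

/-- A central element that kills `a` kills its central support. -/
theorem mul_centralSupport_eq_zero {M : VonNeumannAlgebra H} {a z : H →L[ℂ] H}
    (hz : z ∈ centre M) (h : z * a = 0) : z * centralSupport M a = 0 := by
  set l := leftSupport (star z) with hl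
  have hlc : l ∈ centre M := leftSupport_mem_centre (star_mem hz)
  have hlp : IsStarProjection l := isStarProjection_leftSupport _
  have h1 : star a * l = 0 := mul_leftSupport_eq_zero (by rw [← star_mul, h, star_zero])
  have h2 : l * a = 0 := by
    have := congrArg star h1
    rwa [star_mul, star_star, hlp.isSelfAdjoint.star_eq, star_zero] at this
  have h3 : (1 - l) * centralSupport M a = centralSupport M a :=
    mul_centralSupport_of_mul (sub_mem (one_mem _) hlc) hlp.one_sub (by rw [sub_mul, h2]; simp)
  have h4 : z * l = z := by
    have := congrArg star (leftSupport_mul (star z))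
    rwa [star_mul, star_star, (isStarProjection_leftSupport _).isSelfAdjoint.star_eq] at this
  rw [← h3, ← mul_assoc, mul_sub, h4]
  simp

/-- If `q M p = 0` then `q` kills the central support of `p`: the closed span of `M p H` is
invariant under `M` and its commutant, so the projection onto it is central. -/
theorem mul_centralSupport_eq_zero_of_forall {M : VonNeumannAlgebra H} {p q : H →L[ℂ] H}
    (hp : p ∈ M) (h : ∀ x ∈ M, q * x * p = 0) : q * centralSupport M p = 0 := by
  set K : Submodule ℂ H := Submodule.span ℂ {ξ | ∃ x ∈ M, ∃ η, ξ = (x * p) η} with hK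
  have hinvM : ∀ y ∈ M, ∀ ξ ∈ K, y ξ ∈ K := by
    intro y hy ξ hξ
    induction hξ using Submodule.span_induction with
    | mem ξ h =>
      obtain ⟨x, hx, η, rfl⟩ := h
      exact Submodule.subset_span ⟨y * x, mul_mem hy hx, η, rfl⟩
    | zero => simp
    | add a b _ _ ha hb => rw [map_add]; exact add_mem ha hb
    | smul c a _ ha => rw [map_smul]; exact K.smul_mem c ha
  have hinvM' : ∀ y ∈ M.commutant, ∀ ξ ∈ K, y ξ ∈ K := by
    intro y hy ξ hξ
    induction hξ using Submodule.span_induction with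
    | mem ξ h =>
      obtain ⟨x, hx, η, rfl⟩ := h
      refine Submodule.subset_span ⟨x, hx, y η, ?_⟩
      exact congrArg (fun T : H →L[ℂ] H => T η) (commute_of_mem_commutant hy (mul_mem hx hp)).eq
    | zero => simp
    | add a b _ _ ha hb => rw [map_add]; exact add_mem ha hb
    | smul c a _ ha => rw [map_smul]; exact K.smul_mem c ha
  set e := K.topologicalClosure.starProjection with he
  have hec : e ∈ centre M := mem_centre_iff.2
    ⟨starProjection_mem _ fun y hy => closure_invariant (hinvM' y hy),
     starProjection_mem _ fun y hy => closure_invariant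
      (hinvM y (by rwa [M.commutant_commutant] at hy))⟩
  have hep : e * p = p := by
    ext ξ
    refine Submodule.starProjection_eq_self_iff.2 (Submodule.le_topologicalClosure _ ?_)
    exact Submodule.subset_span ⟨1, one_mem _, ξ, by simp⟩
  have hqe : q * e = 0 := by
    refine mul_starProjection_closure_eq_zero fun ξ hξ => ?_
    induction hξ using Submodule.span_induction with
    | mem ξ h' =>
      obtain ⟨x, hx, η, rfl⟩ := h'
      exact congrArg (fun T : H →L[ℂ] H => T η) (h x hx)
    | zero => simp
    | add a b _ _ ha hb => rw [map_add, ha, hb, add_zero]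
    | smul c a _ ha => rw [map_smul, ha, smul_zero]
  rw [← mul_centralSupport_of_mul hec isStarProjection_starProjection hep, ← mul_assoc, hqe,
    zero_mul]

/-! ### Strong operator sums of orthogonal families -/

/-- `D` is the sum of the family `T` in the strong operator topology. -/
def SOTSum {ι : Type*} (T : ι → H →L[ℂ] H) (D : H →L[ℂ] H) : Prop :=
  ∀ x, HasSum (fun i => T i x) (D x)

namespace SOTSum

variable {ι : Type*} {T : ι → H →L[ℂ] H} {D D' : H →L[ℂ] H}

theorem unique (h : SOTSum T D) (h' : SOTSum T D') : D = D' := by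
  ext x
  exact (h x).unique (h' x)

theorem mul_left (A : H →L[ℂ] H) (h : SOTSum T D) : SOTSum (fun i => A * T i) (A * D) :=
  fun x => (h x).mapL A

theorem mul_right (A : H →L[ℂ] H) (h : SOTSum T D) : SOTSum (fun i => T i * A) (D * A) :=
  fun x => h (A x)

theorem single (i : ι) (h : ∀ j, j ≠ i → T j = 0) : SOTSum T (T i) :=
  fun x => hasSum_single i fun j hj => by rw [h j hj]; rfl

theorem zero : SOTSum (fun _ : ι => (0 : H →L[ℂ] H)) 0 := fun _ => hasSum_zero

theorem add {S : ι → H →L[ℂ] H} (h : SOTSum T D) (h' : SOTSum S D') :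
    SOTSum (fun i => T i + S i) (D + D') :=
  fun x => (h x).add (h' x)

theorem star_eq (h : SOTSum T D) (h' : SOTSum (fun i => star (T i)) D') : star D = D' := by
  symm
  rw [ContinuousLinearMap.star_eq_adjoint, ContinuousLinearMap.eq_adjoint_iff]
  intro x y
  have h1 : HasSum (fun i => inner ℂ (star (T i) x) y) (inner ℂ (D' x) y) :=
    (h' x).mapL ((innerSLFlip ℂ) y : H →L⋆[ℂ] ℂ)
  have h2 : HasSum (fun i => inner ℂ x (T i y)) (inner ℂ x (D y)) := (h y).mapL (innerSL ℂ x)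
  refine h1.unique ?_
  convert h2 using 2 with i
  rw [ContinuousLinearMap.star_eq_adjoint, ContinuousLinearMap.adjoint_inner_left]

theorem mem {M : VonNeumannAlgebra H} (h : SOTSum T D) (hT : ∀ i, T i ∈ M) : D ∈ M := by
  refine mem_of_forall_commute fun y hy => (h.mul_left y).unique ?_
  simp only [(commute_of_mem_commutant hy (hT _)).eq]
  exact h.mul_right y

theorem mul_eq_of_orthogonal (h : SOTSum T D) {A : H →L[ℂ] H} (i : ι)
    (hA : ∀ j, j ≠ i → T j * A = 0) : D * A = T i * A :=
  (h.mul_right A).unique (single (T := fun j => T j * A) i hA)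

theorem mul_eq_of_orthogonal' (h : SOTSum T D) {A : H →L[ℂ] H} (i : ι)
    (hA : ∀ j, j ≠ i → A * T j = 0) : A * D = A * T i :=
  (h.mul_left A).unique (single (T := fun j => A * T j) i hA)

theorem of_finset {κ : Type*} [Fintype κ] (T : κ → H →L[ℂ] H) : SOTSum T (∑ i, T i) := by
  intro x
  have := hasSum_fintype fun i => T i x
  rwa [sum_apply]

end SOTSum

theorem inner_apply_eq_norm_sq {p : H →L[ℂ] H} (hp : IsStarProjection p) (ξ : H) :
    RCLike.re (inner ℂ (p ξ) ξ) = ‖p ξ‖ ^ 2 := by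
  rw [← inner_self_eq_norm_sq (𝕜 := ℂ)]
  nth_rewrite 3 [← hp.isSelfAdjoint.star_eq]
  rw [ContinuousLinearMap.star_eq_adjoint, ContinuousLinearMap.adjoint_inner_right]
  congr 2
  exact (congrArg (fun T : H →L[ℂ] H => T ξ) hp.isIdempotentElem.eq).symm

/-- Pairwise orthogonal projections have `∑ ‖r i x‖ ^ 2 ≤ ‖x‖ ^ 2` over finite sets. -/
theorem sum_norm_sq_le {ι : Type*} {r : ι → H →L[ℂ] H} (hr : ∀ i, IsStarProjection (r i))
    (horth : Pairwise fun i j => r i * r j = 0) (F : Finset ι) (x : H) :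
    ∑ i ∈ F, ‖r i x‖ ^ 2 ≤ ‖x‖ ^ 2 := by
  classical
  have hP : IsStarProjection (∑ i ∈ F, r i) := by
    induction F using Finset.induction_on with
    | empty => simp
    | insert a s ha ih =>
      rw [Finset.sum_insert ha]
      refine isStarProjection_add (hr a) ih ?_
      rw [Finset.mul_sum]
      exact Finset.sum_eq_zero fun j hj => horth fun h => ha (h ▸ hj)
  calc ∑ i ∈ F, ‖r i x‖ ^ 2 = RCLike.re (inner ℂ ((∑ i ∈ F, r i) x) x) := by
        simp only [← inner_apply_eq_norm_sq (hr _), sum_apply, sum_inner, map_sum]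
    _ ≤ ‖(∑ i ∈ F, r i) x‖ * ‖x‖ := re_inner_le_norm _ _
    _ ≤ (1 * ‖x‖) * ‖x‖ := by
        gcongr
        exact ContinuousLinearMap.le_of_opNorm_le _ hP.norm_le _
    _ = ‖x‖ ^ 2 := by ring

/-- A bounded family whose members have pairwise orthogonal ranges and pairwise orthogonal
co-ranges is summable in the strong operator topology. -/
theorem exists_sotSum {ι : Type*} {T : ι → H →L[ℂ] H} (C : ℝ) (hC : ∀ i, ‖T i‖ ≤ C)
    (h1 : Pairwise fun i j => star (T i) * T j = 0)
    (h2 : Pairwise fun i j => T i * star (T j) = 0) : ∃ D, SOTSum T D := by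
  set r : ι → H →L[ℂ] H := fun i => leftSupport (star (T i)) with hr
  have hrp : ∀ i, IsStarProjection (r i) := fun i => isStarProjection_leftSupport _
  have hTr : ∀ i, T i * r i = T i := fun i => by
    have := congrArg star (leftSupport_mul (star (T i)))
    rwa [star_mul, star_star, (hrp i).isSelfAdjoint.star_eq] at this
  have horth : Pairwise fun i j => r i * r j = 0 := by
    intro i j hij
    refine mul_leftSupport_eq_zero ?_
    have : T j * r i = 0 := mul_leftSupport_eq_zero (h2 hij.symm)
    have := congrArg star this
    rwa [star_mul, (hrp i).isSelfAdjoint.star_eq, star_zero] at this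
  have hbound : ∀ i x, ‖T i x‖ ^ 2 ≤ C ^ 2 * ‖r i x‖ ^ 2 := by
    intro i x
    have : T i x = T i (r i x) := congrArg (fun S : H →L[ℂ] H => S x) (hTr i).symm
    rw [this, ← mul_pow]
    gcongr
    exact ContinuousLinearMap.le_of_opNorm_le _ (hC i) _
  have hsum : ∀ (F : Finset ι) x, ∑ i ∈ F, ‖T i x‖ ^ 2 ≤ C ^ 2 * ‖x‖ ^ 2 := by
    intro F x
    calc ∑ i ∈ F, ‖T i x‖ ^ 2 ≤ ∑ i ∈ F, C ^ 2 * ‖r i x‖ ^ 2 :=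
          Finset.sum_le_sum fun i _ => hbound i x
      _ = C ^ 2 * ∑ i ∈ F, ‖r i x‖ ^ 2 := by rw [Finset.mul_sum]
      _ ≤ C ^ 2 * ‖x‖ ^ 2 := by
          gcongr
          exact sum_norm_sq_le hrp horth F x
  have hV : OrthogonalFamily ℂ (fun i => LinearMap.range (T i : H →ₗ[ℂ] H))
      fun i => (LinearMap.range (T i : H →ₗ[ℂ] H)).subtypeₗᵢ := by
    rintro i j hij ⟨_, x, rfl⟩ ⟨_, y, rfl⟩
    change inner ℂ (T i x) (T j y) = 0
    rw [← ContinuousLinearMap.adjoint_inner_right, ← ContinuousLinearMap.star_eq_adjoint]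
    have := congrArg (fun S : H →L[ℂ] H => S y) (h1 hij)
    simp only [mul_apply_eq_comp, zero_apply] at this
    rw [this, inner_zero_right]
  have hsm : ∀ x, Summable fun i => T i x := fun x =>
    (hV.summable_iff_norm_sq_summable fun i => ⟨T i x, x, rfl⟩).2
      (summable_of_sum_le (fun i => by positivity) fun F => hsum F x)
  have hnorm : ∀ x, ‖∑' i, T i x‖ ≤ |C| * ‖x‖ := by
    intro x
    refine le_of_tendsto (hsm x).hasSum.norm (Eventually.of_forall fun F => ?_)
    have h3 : ‖∑ i ∈ F, T i x‖ ^ 2 = ∑ i ∈ F, ‖T i x‖ ^ 2 :=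
      hV.norm_sum (fun i => ⟨T i x, x, rfl⟩) F
    refine abs_le_of_sq_le_sq' ?_ (by positivity) |>.2
    rw [h3, mul_pow, sq_abs]
    exact hsum F x
  refine ⟨LinearMap.mkContinuous
    { toFun := fun x => ∑' i, T i x
      map_add' := fun x y => by simp only [map_add]; exact (hsm x).tsum_add (hsm y)
      map_smul' := fun c x => by
        simp only [map_smul, RingHom.id_apply]; exact (hsm x).tsum_const_smul c } |C| hnorm,
    fun x => (hsm x).hasSum⟩

/-- Orthogonal projections have a sum, which is a projection dominating each of them. -/
theorem exists_sum_projections {ι : Type*} {p : ι → H →L[ℂ] H}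
    (hp : ∀ i, IsStarProjection (p i)) (horth : Pairwise fun i j => p i * p j = 0) :
    ∃ P, SOTSum p P ∧ IsStarProjection P ∧ ∀ i, P * p i = p i := by
  have hs : ∀ i, star (p i) = p i := fun i => (hp i).isSelfAdjoint.star_eq
  obtain ⟨P, hP⟩ := exists_sotSum (T := p) 1 (fun i => (hp i).norm_le)
    (by simpa only [hs] using horth) (by simpa only [hs] using horth)
  have hPp : ∀ i, P * p i = p i := fun i => by
    rw [hP.mul_eq_of_orthogonal i fun j hj => horth hj, (hp i).isIdempotentElem.eq]
  refine ⟨P, hP, ⟨?_, hP.star_eq (by simpa only [hs] using hP)⟩, hPp⟩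
  refine (hP.mul_left P).unique ?_
  simpa only [hPp] using hP

theorem SOTSum.isStarProjection {ι : Type*} {p : ι → H →L[ℂ] H} {P : H →L[ℂ] H}
    (hP : SOTSum p P) (hp : ∀ i, IsStarProjection (p i))
    (horth : Pairwise fun i j => p i * p j = 0) :
    IsStarProjection P ∧ ∀ i, P * p i = p i := by
  obtain ⟨Q, hQ, h⟩ := exists_sum_projections hp horth
  rwa [hP.unique hQ]

/-! ### Murray-von Neumann equivalence -/

section Equivalence

variable {M : VonNeumannAlgebra H} {p q r : H →L[ℂ] H}

theorem partialIsometry_mul {v : H →L[ℂ] H} (h : IsStarProjection (star v * v)) :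
    v * (star v * v) = v := by
  have h0 : star (v - v * (star v * v)) * (v - v * (star v * v)) = 0 := by
    have := h.isIdempotentElem.eq
    simp only [star_sub, star_mul, star_star, sub_mul, mul_sub]
    simp only [mul_assoc] at this ⊢
    simp only [this]
    abel
  exact (sub_eq_zero.1 ((CStarRing.star_mul_self_eq_zero_iff _).1 h0)).symm

theorem mul_partialIsometry {v : H →L[ℂ] H} (h : IsStarProjection (v * star v)) :
    v * star v * v = v := by
  have := congrArg star (partialIsometry_mul (v := star v) (by rwa [star_star]))
  rw [star_star, star_mul, star_mul, star_star] at this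
  exact this

theorem MvNEquiv.refl (hp : p ∈ projections M) : MvNEquiv M p p :=
  ⟨p, hp.1, by rw [hp.2.isSelfAdjoint.star_eq, hp.2.isIdempotentElem.eq],
    by rw [hp.2.isSelfAdjoint.star_eq, hp.2.isIdempotentElem.eq]⟩

theorem MvNEquiv.symm (h : MvNEquiv M p q) : MvNEquiv M q p := by
  obtain ⟨v, hv, h1, h2⟩ := h
  exact ⟨star v, star_mem hv, by rwa [star_star], by rwa [star_star]⟩

/-- A partial isometry from `p` to `q` with the absorption relations it satisfies. -/
theorem MvNEquiv.exists (hp : p ∈ projections M) (hq : q ∈ projections M)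
    (h : MvNEquiv M p q) :
    ∃ v ∈ M, star v * v = p ∧ v * star v = q ∧ v * p = v ∧ q * v = v := by
  obtain ⟨v, hv, h1, h2⟩ := h
  refine ⟨v, hv, h1, h2, ?_, ?_⟩
  · rw [← h1]; exact partialIsometry_mul (h1 ▸ hp.2)
  · rw [← h2]; exact mul_partialIsometry (h2 ▸ hq.2)

theorem MvNEquiv.trans (hp : p ∈ projections M) (hq : q ∈ projections M)
    (hr : r ∈ projections M) (h : MvNEquiv M p q) (h' : MvNEquiv M q r) : MvNEquiv M p r := by
  obtain ⟨v, hv, h1, h2, -, h4⟩ := h.exists hp hq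
  obtain ⟨w, hw, k1, k2, k3, -⟩ := h'.exists hq hr
  refine ⟨w * v, mul_mem hw hv, ?_, ?_⟩
  · rw [star_mul, mul_assoc, ← mul_assoc (star w), k1, h4, h1]
  · rw [star_mul, mul_assoc, ← mul_assoc v, h2, ← mul_assoc, k3, k2]

/-- Conjugation by a partial isometry from `p` carries subprojections of `p` to equivalent
projections. -/
theorem conj_subprojection {v : H →L[ℂ] H} (hv : v ∈ M) (hp : star v * v = p)
    (hr : r ∈ projections M) (hrp : p * r = r) :
    v * r * star v ∈ projections M ∧ MvNEquiv M r (v * r * star v) ∧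
      v * star v * (v * r * star v) = v * r * star v := by
  have hrs := hr.2.isSelfAdjoint.star_eq
  have hri := hr.2.isIdempotentElem.eq
  have hmul : ∀ s, v * r * star v * (v * r * s) = v * r * s := fun s => by
    calc v * r * star v * (v * r * s) = v * (r * ((star v * v) * r)) * s := by noncomm_ring
      _ = v * r * s := by rw [hp, hrp, hri]
  refine ⟨⟨mul_mem (mul_mem hv hr.1) (star_mem hv), ⟨hmul _, ?_⟩⟩,
    ⟨v * r, mul_mem hv hr.1, ?_, ?_⟩, ?_⟩
  · simp [IsSelfAdjoint, star_mul, hrs, mul_assoc]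
  · rw [star_mul, hrs, mul_assoc, ← mul_assoc (star v), hp, hrp, hri]
  · rw [star_mul, hrs, mul_assoc, ← mul_assoc r, hri, mul_assoc]
  · calc v * star v * (v * r * star v) = v * ((star v * v) * r) * star v := by noncomm_ring
      _ = v * r * star v := by rw [hp, hrp]

theorem central_mul_mem_projections {z : H →L[ℂ] H} (hz : z ∈ centralProjections M)
    (hp : p ∈ projections M) : z * p ∈ projections M :=
  ⟨mul_mem hz.1.1 hp.1, isStarProjection_mul hz.2 hp.2 (commute_of_mem_centre hz.1 hp.1)⟩

theorem MvNEquiv.central_mul {z : H →L[ℂ] H} (hz : z ∈ centralProjections M)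
    (h : MvNEquiv M p q) : MvNEquiv M (z * p) (z * q) := by
  obtain ⟨v, hv, h1, h2⟩ := h
  have hzi := hz.2.isIdempotentElem.eq
  have hc := (commute_of_mem_centre hz.1 (star_mem hv)).eq
  have hc' := (commute_of_mem_centre hz.1 hv).eq
  refine ⟨z * v, mul_mem hz.1.1 hv, ?_, ?_⟩
  · rw [star_mul, hz.2.isSelfAdjoint.star_eq, ← hc, ← h1]
    calc z * star v * (z * v) = z * (star v * z) * v := by noncomm_ring
      _ = (z * z) * (star v * v) := by rw [← hc]; noncomm_ring
      _ = _ := by rw [hzi]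
  · rw [star_mul, hz.2.isSelfAdjoint.star_eq, ← hc, ← h2]
    calc z * v * (z * star v) = z * (v * z) * star v := by noncomm_ring
      _ = (z * z) * (v * star v) := by rw [← hc']; noncomm_ring
      _ = _ := by rw [hzi]

/-- Orthogonal sums of equivalent projections are equivalent: the partial isometries add up in
the strong operator topology. -/
theorem MvNEquiv.sum {ι : Type*} {p q : ι → H →L[ℂ] H} {P Q : H →L[ℂ] H}
    (hp : ∀ i, p i ∈ projections M) (hq : ∀ i, q i ∈ projections M)
    (hpo : Pairwise fun i j => p i * p j = 0) (hqo : Pairwise fun i j => q i * q j = 0)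
    (hP : SOTSum p P) (hQ : SOTSum q Q) (h : ∀ i, MvNEquiv M (p i) (q i)) :
    ∃ V ∈ M, star V * V = P ∧ V * star V = Q ∧ ∀ i, q i * V = V * p i := by
  choose v hv h1 h2 h3 h4 using fun i => (h i).exists (hp i) (hq i)
  have hsq : ∀ i, star (v i) * q i = star (v i) := fun i => by
    have := congrArg star (h4 i)
    rwa [star_mul, (hq i).2.isSelfAdjoint.star_eq] at this
  have hsp : ∀ i, p i * star (v i) = star (v i) := fun i => by
    have := congrArg star (h3 i)
    rwa [star_mul, (hp i).2.isSelfAdjoint.star_eq] at this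
  have o1 : Pairwise fun i j => star (v i) * v j = 0 := fun i j hij => by
    change star (v i) * v j = 0
    rw [← hsq i, ← h4 j, mul_assoc, ← mul_assoc (q i), hqo hij]; simp
  have o2 : Pairwise fun i j => v i * star (v j) = 0 := fun i j hij => by
    change v i * star (v j) = 0
    rw [← h3 i, ← hsp j, mul_assoc, ← mul_assoc (p i), hpo hij]; simp
  have hn : ∀ i, ‖v i‖ ≤ 1 := fun i => by
    have h5 : ‖v i‖ * ‖v i‖ ≤ 1 := by
      rw [← CStarRing.norm_star_mul_self, h1]; exact (hp i).2.norm_le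
    nlinarith [norm_nonneg (v i)]
  obtain ⟨V, hV⟩ := exists_sotSum (T := v) 1 hn o1 o2
  obtain ⟨W, hW⟩ := exists_sotSum (T := fun i => star (v i)) 1
    (fun i => by rw [norm_star]; exact hn i) (by simpa only [star_star] using o2)
    (by simpa only [star_star] using o1)
  have hVW : star V = W := hV.star_eq hW
  refine ⟨V, hV.mem hv, ?_, ?_, fun i => ?_⟩
  · rw [hVW]
    refine (hV.mul_left W).unique ?_
    have : ∀ i, W * v i = p i := fun i => by
      rw [hW.mul_eq_of_orthogonal i fun j hj => o1 hj, h1]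
    simpa only [this] using hP
  · rw [hVW]
    refine (hW.mul_left V).unique ?_
    have : ∀ i, V * star (v i) = q i := fun i => by
      rw [hV.mul_eq_of_orthogonal i fun j hj => o2 hj, h2]
    simpa only [this] using hQ
  · rw [hV.mul_eq_of_orthogonal' i fun j hj => by
      rw [← h4 j, ← mul_assoc, hqo hj.symm, zero_mul],
      hV.mul_eq_of_orthogonal i fun j hj => by
      rw [← h3 j, mul_assoc, hpo hj, mul_zero], h3, h4]

end Equivalence

/-! ### Comparison of projections -/

section Comparison

variable {M : VonNeumannAlgebra H} {p q r : H →L[ℂ] H}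

/-- Polar decomposition: a nonzero element of `q M p` yields nonzero equivalent subprojections
of `p` and `q`. -/
theorem exists_equiv_subprojections (hp : p ∈ projections M) {y : H →L[ℂ] H} (hy : y ∈ M)
    (h0 : y ≠ 0) (hyp : y * p = y) (hqy : q * y = y) :
    ∃ r ∈ projections M, ∃ s ∈ projections M, s ≠ 0 ∧ MvNEquiv M s r ∧ p * r = r ∧
      q * s = s := by
  set A := CFC.abs y with hA
  have hAM : A ∈ M := mem_of_forall_commute fun T hT =>
    (Commute.cfcAbs_left (commute_of_mem_commutant hT hy).symm
      (commute_of_mem_commutant (star_mem hT) hy).symm).symm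
  have hAs : star A = A := (CFC.abs_nonneg y).isSelfAdjoint.star_eq
  have hAn : ∀ x, ‖A x‖ = ‖y x‖ := by
    intro x
    have key : ∀ T : H →L[ℂ] H, ‖T x‖ ^ 2 = RCLike.re (inner ℂ ((star T * T) x) x) := by
      intro T
      rw [mul_apply_eq_comp, ContinuousLinearMap.star_eq_adjoint,
        ContinuousLinearMap.adjoint_inner_left, inner_self_eq_norm_sq]
    have h1 : ‖A x‖ ^ 2 = ‖y x‖ ^ 2 := by rw [key, key, hAs, CFC.abs_mul_abs]
    exact (sq_eq_sq₀ (norm_nonneg _) (norm_nonneg _)).1 h1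
  set K := (LinearMap.range (A : H →ₗ[ℂ] H)).topologicalClosure with hK
  set R := leftSupport A with hR
  have hRp : IsStarProjection R := isStarProjection_leftSupport A
  have hRM : R ∈ M := leftSupport_mem hAM
  -- `y` factors through `|y|` by an isometry from the closed range of `|y|`.
  let A' : H →ₗ[ℂ] K := (A : H →ₗ[ℂ] H).codRestrict K
    fun x => Submodule.le_topologicalClosure _ (LinearMap.mem_range_self _ x)
  have hA'd : DenseRange A' := by
    intro k
    rw [Topology.IsInducing.subtypeVal.closure_eq_preimage_closure_image, Set.mem_preimage]
    have : (Subtype.val '' Set.range A' : Set H) = LinearMap.range (A : H →ₗ[ℂ] H) := by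
      ext z
      constructor
      · rintro ⟨_, ⟨x, rfl⟩, rfl⟩; exact ⟨x, rfl⟩
      · rintro ⟨x, rfl⟩; exact ⟨A' x, ⟨x, rfl⟩, rfl⟩
    exact closure_mono this.ge k.2
  let f : K →L[ℂ] H := (y : H →ₗ[ℂ] H).extendOfNorm A'
  have hf : ∀ x, f (A' x) = y x := fun x =>
    LinearMap.extendOfNorm_eq (f := (y : H →ₗ[ℂ] H)) hA'd
      ⟨1, fun x => by rw [one_mul]; exact (hAn x).ge⟩ x
  have hfn : ∀ k, ‖f k‖ = ‖k‖ := fun k => by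
    refine hA'd.induction_on (p := fun k => ‖f k‖ = ‖k‖) k
      (isClosed_eq f.continuous.norm continuous_norm) fun x => ?_
    rw [hf]
    exact (hAn x).symm
  set v : H →L[ℂ] H := f ∘L K.orthogonalProjectionOnto with hv
  have hvA : v * A = y := by
    ext x
    have h1 : K.orthogonalProjectionOnto (A x) = A' x :=
      Submodule.orthogonalProjectionOnto_mem_subspace_eq_self (A' x)
    change f (K.orthogonalProjectionOnto (A x)) = y x
    rw [h1, hf]
  have hvR : v * R = v := by
    ext x
    change f (K.orthogonalProjectionOnto (K.orthogonalProjectionOnto x : H)) = f _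
    rw [Submodule.orthogonalProjectionOnto_mem_subspace_eq_self]
    rfl
  have hvv : star v * v = R := by
    rw [← sub_eq_zero]
    have : ((star v * v - R : H →L[ℂ] H) : H →ₗ[ℂ] H) = 0 := by
      rw [← inner_map_self_eq_zero]
      intro x
      change inner ℂ ((star v * v - R : H →L[ℂ] H) x) x = 0
      have h1 : ‖v x‖ = ‖R x‖ := hfn (K.orthogonalProjectionOnto x)
      have h2 : inner ℂ (R x) x = inner ℂ (R x) (R x) := by
        nth_rewrite 3 [← hRp.isSelfAdjoint.star_eq]
        rw [ContinuousLinearMap.star_eq_adjoint, ContinuousLinearMap.adjoint_inner_right]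
        congr 1
        exact (congrArg (fun T : H →L[ℂ] H => T x) hRp.isIdempotentElem.eq).symm
      rw [sub_apply, inner_sub_left, mul_apply_eq_comp,
        ContinuousLinearMap.star_eq_adjoint, ContinuousLinearMap.adjoint_inner_left,
        h2, inner_self_eq_norm_sq_to_K, inner_self_eq_norm_sq_to_K, h1, sub_self]
    ext x
    exact congrArg (fun T : H →ₗ[ℂ] H => T x) this
  have hvM : v ∈ M := by
    refine mem_of_forall_commute fun T hT => ?_
    have h1 : (T * v - v * T) * R = 0 := mul_leftSupport_eq_zero (by
      rw [sub_mul, mul_assoc, mul_assoc, hvA, (commute_of_mem_commutant hT hAM).eq,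
        ← mul_assoc, hvA, (commute_of_mem_commutant hT hy).eq, sub_self])
    rw [sub_mul, mul_assoc, mul_assoc, (commute_of_mem_commutant hT hRM).eq, ← mul_assoc v,
      hvR, sub_eq_zero] at h1
    exact h1
  have hvs : v * star v * (v * star v) = v * star v := by
    rw [← mul_assoc, mul_assoc v, hvv, hvR]
  have hpA : p * A = A := by
    have : A * p = A := by
      rw [← sub_eq_zero, ← mul_sub_one]
      ext x
      rw [mul_apply_eq_comp, zero_apply, ← norm_eq_zero, hAn, ← mul_apply_eq_comp,
        mul_sub_one, hyp, sub_self, zero_apply, norm_zero]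
    have := congrArg star this
    rwa [star_mul, hAs, hp.2.isSelfAdjoint.star_eq] at this
  have hqv : q * v = v := by
    have h1 : (1 - q) * v * R = 0 := mul_leftSupport_eq_zero (by
      rw [mul_assoc, hvA, sub_mul, hqy, one_mul, sub_self])
    rw [mul_assoc, hvR, sub_mul, one_mul, sub_eq_zero] at h1
    exact h1.symm
  refine ⟨R, ⟨hRM, hRp⟩, v * star v, ⟨mul_mem hvM (star_mem hvM), hvs, ?_⟩, ?_,
    ⟨star v, star_mem hvM, by rw [star_star], by rw [star_star, hvv]⟩,
    mul_leftSupport_of_mul hpA, by rw [← mul_assoc, hqv]⟩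
  · simp [IsSelfAdjoint]
  · intro h
    rw [CStarRing.mul_star_self_eq_zero_iff] at h
    exact h0 (by rw [← hvA, h, zero_mul])

/-- `p ≼ q`: the projection `p` is equivalent to a subprojection of `q`. -/
def Subequiv (M : VonNeumannAlgebra H) (p q : H →L[ℂ] H) : Prop :=
  ∃ r ∈ projections M, MvNEquiv M p r ∧ q * r = r

theorem MvNEquiv.add {p₁ p₂ q₁ q₂ : H →L[ℂ] H} (hp₁ : p₁ ∈ projections M)
    (hp₂ : p₂ ∈ projections M) (hq₁ : q₁ ∈ projections M) (hq₂ : q₂ ∈ projections M)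
    (hp : p₁ * p₂ = 0) (hq : q₁ * q₂ = 0) (h₁ : MvNEquiv M p₁ q₁) (h₂ : MvNEquiv M p₂ q₂) :
    MvNEquiv M (p₁ + p₂) (q₁ + q₂) := by
  have orth : ∀ {a b : H →L[ℂ] H}, a ∈ projections M → b ∈ projections M → a * b = 0 →
      Pairwise fun i j => cond i a b * cond j a b = 0 := by
    rintro a b ha hb hab (_ | _) (_ | _) hij <;> simp_all [orth_symm ha.2 hb.2 hab]
  have hP := SOTSum.of_finset fun i : Bool => cond i p₁ p₂
  have hQ := SOTSum.of_finset fun i : Bool => cond i q₁ q₂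
  rw [Fintype.sum_bool] at hP hQ
  obtain ⟨V, hV, h3, h4, -⟩ := MvNEquiv.sum (by rintro (_ | _) <;> assumption)
    (by rintro (_ | _) <;> assumption) (orth hp₁ hp₂ hp) (orth hq₁ hq₂ hq) hP hQ
    (by rintro (_ | _) <;> assumption)
  exact ⟨V, hV, h3, h4⟩

/-- The orbit of a projection `s₀ ≤ p` orthogonal to the range of an isometry `x` of `p` into
itself consists of pairwise orthogonal equivalent projections. -/
theorem exists_orthogonal_orbit {x s₀ : H →L[ℂ] H} (hx : x ∈ M) (hxp : star x * x = p)
    (hpx : p * x = x) (hs₀ : s₀ ∈ projections M) (hps : p * s₀ = s₀) (hxs : star x * s₀ = 0) :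
    ∃ s : ℕ → H →L[ℂ] H, s 0 = s₀ ∧ (∀ n, s (n + 1) = x * s n * star x) ∧
      (∀ n, s n ∈ projections M) ∧ (∀ n, MvNEquiv M s₀ (s n)) ∧ (∀ n, p * s n = s n) ∧
      Pairwise fun m n => s m * s n = 0 := by
  let s : ℕ → H →L[ℂ] H := fun n => Nat.rec s₀ (fun _ t => x * t * star x) n
  have hsucc : ∀ n, s (n + 1) = x * s n * star x := fun n => rfl
  have hall : ∀ n, s n ∈ projections M ∧ MvNEquiv M s₀ (s n) ∧ p * s n = s n := by
    intro n
    induction n with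
    | zero => exact ⟨hs₀, MvNEquiv.refl hs₀, hps⟩
    | succ n ih =>
      obtain ⟨h1, h2, -⟩ := conj_subprojection hx hxp ih.1 ih.2.2
      rw [hsucc]
      exact ⟨h1, ih.2.1.trans hs₀ ih.1 h1 h2, by rw [mul_assoc, ← mul_assoc p, hpx]⟩
  have hs0x : s₀ * x = 0 := by
    have := congrArg star hxs
    rwa [star_mul, star_star, hs₀.2.isSelfAdjoint.star_eq, star_zero] at this
  have hlt : ∀ m k, s m * s (m + k + 1) = 0 := by
    intro m
    induction m with
    | zero =>
      intro k
      rw [hsucc, ← mul_assoc, ← mul_assoc]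
      change s₀ * x * _ * _ = 0
      rw [hs0x, zero_mul, zero_mul]
    | succ m ih =>
      intro k
      have e : m + 1 + k + 1 = (m + k + 1) + 1 := by omega
      rw [e, hsucc, hsucc (m + k + 1)]
      calc x * s m * star x * (x * s (m + k + 1) * star x)
          = x * (s m * ((star x * x) * s (m + k + 1))) * star x := by noncomm_ring
        _ = 0 := by rw [hxp, (hall (m + k + 1)).2.2, ih, mul_zero, zero_mul]
  refine ⟨s, rfl, hsucc, fun n => (hall n).1, fun n => (hall n).2.1, fun n => (hall n).2.2, ?_⟩
  intro m n hmn
  rcases lt_or_gt_of_ne hmn with h | h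
  · obtain ⟨k, rfl⟩ := Nat.exists_eq_add_of_lt h
    exact hlt m k
  · obtain ⟨k, rfl⟩ := Nat.exists_eq_add_of_lt h
    exact orth_symm (hall n).1.2 (hall (n + k + 1)).1.2 (hlt n k)

/-- Schröder-Bernstein for projections. -/
theorem Subequiv.antisymm (hp : p ∈ projections M) (hq : q ∈ projections M)
    (h : Subequiv M p q) (h' : Subequiv M q p) : MvNEquiv M p q := by
  obtain ⟨q₁, hq₁, hpq, hqq⟩ := h
  obtain ⟨p₁, hp₁, hqp, hpp⟩ := h'
  obtain ⟨v, hv, v1, v2, v3, v4⟩ := hpq.exists hp hq₁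
  obtain ⟨w, hw, w1, w2, w3, w4⟩ := hqp.exists hq hp₁
  have hqv : q * v = v := by rw [← v4, ← mul_assoc, hqq]
  have hpw : p * w = w := by rw [← w4, ← mul_assoc, hpp]
  have hwp : star w * p = star w := by
    have := congrArg star hpw
    rwa [star_mul, hp.2.isSelfAdjoint.star_eq] at this
  have hs₀ : p - p₁ ∈ projections M :=
    ⟨sub_mem hp.1 hp₁.1, isStarProjection_sub hp₁.2 hp.2 hpp⟩
  have hwp₁ : star w * p₁ = star w := by
    have := congrArg star w4
    rwa [star_mul, hp₁.2.isSelfAdjoint.star_eq] at this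
  obtain ⟨s, hs0, hs1, hs2, -, hs4, hs5⟩ := exists_orthogonal_orbit (x := w * v) (p := p)
    (mul_mem hw hv) (by rw [star_mul, mul_assoc, ← mul_assoc (star w), w1, hqv, v1])
    (by rw [← mul_assoc, hpw]) hs₀ (by rw [mul_sub, hpp, hp.2.isIdempotentElem.eq])
    (by rw [star_mul, mul_assoc, mul_sub, hwp, hwp₁, sub_self, mul_zero])
  obtain ⟨e, he, hep, hes⟩ := exists_sum_projections (fun n => (hs2 n).2) hs5
  have heM : e ∈ projections M := ⟨he.mem fun n => (hs2 n).1, hep⟩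
  have hpe : p * e = e := (he.mul_left p).unique (by simpa only [hs4] using he)
  -- The fixed point equation `e = (p - p₁) + x e x*` with `x = w v`.
  have hfix : e = (p - p₁) + w * v * e * star (w * v) := by
    have h1 : SOTSum (fun n => s (n + 1)) (w * v * e * star (w * v)) := by
      simpa only [hs1] using (he.mul_left (w * v)).mul_right (star (w * v))
    ext ξ
    have h2 := (hasSum_nat_add_iff' 1).2 (he ξ)
    rw [Finset.sum_range_one, hs0] at h2
    have h3 := (h1 ξ).unique h2
    rw [add_apply, h3]
    abel
  obtain ⟨g1, g2, g3⟩ := conj_subprojection hv v1 heM hpe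
  have g4 : q * (v * e * star v) = v * e * star v := by rw [← mul_assoc, ← mul_assoc, hqv]
  have g5 : q - v * e * star v ∈ projections M :=
    ⟨sub_mem hq.1 g1.1, isStarProjection_sub g1.2 hq.2 g4⟩
  have g6 : q * (q - v * e * star v) = q - v * e * star v := by
    rw [mul_sub, g4, hq.2.isIdempotentElem.eq]
  obtain ⟨k1, k2, -⟩ := conj_subprojection hw w1 g5 g6
  have k3 : w * (q - v * e * star v) * star w = p - e := by
    have hfix' : e = p - p₁ + w * (v * e * star v) * star w := by
      conv_lhs => rw [hfix, star_mul]
      simp only [mul_assoc]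
    rw [mul_sub, sub_mul, w3, w2, sub_eq_sub_iff_add_eq_add]
    conv_lhs => rw [hfix']
    abel
  rw [k3] at k1 k2
  have := MvNEquiv.add heM k1 g1 g5 (by rw [mul_sub, projSub_mul hp.2 hep hpe,
      hep.isIdempotentElem.eq, sub_self])
    (by rw [mul_sub, projSub_mul hq.2 g1.2 g4, g1.2.isIdempotentElem.eq, sub_self]) g2 k2.symm
  simpa using this

/-! ### Projections that contain infinitely many copies of themselves -/

/-- A projection is stable if it dominates a sequence of pairwise orthogonal projections, all
equivalent to it. -/
def IsStable (M : VonNeumannAlgebra H) (r : H →L[ℂ] H) : Prop :=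
  ∃ s : ℕ → H →L[ℂ] H, (∀ n, s n ∈ projections M) ∧ (Pairwise fun m n => s m * s n = 0) ∧
    (∀ n, r * s n = s n) ∧ ∀ n, MvNEquiv M (s n) r

theorem IsStable.of_equiv (hr : r ∈ projections M) (hq : q ∈ projections M)
    (h : IsStable M r) (hrq : MvNEquiv M r q) : IsStable M q := by
  obtain ⟨s, hs, ho, hle, heq⟩ := h
  obtain ⟨v, hv, h1, h2⟩ := id hrq
  have hc := fun n => conj_subprojection hv h1 (hs n) (hle n)
  refine ⟨fun n => v * s n * star v, fun n => (hc n).1, fun m n hmn => ?_, fun n => ?_,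
    fun n => ?_⟩
  · calc v * s m * star v * (v * s n * star v)
        = v * (s m * ((star v * v) * s n)) * star v := by noncomm_ring
      _ = 0 := by rw [h1, hle, ho hmn, mul_zero, zero_mul]
  · rw [← h2]; exact (hc n).2.2
  · exact (hc n).2.1.symm.trans (hc n).1 (hs n) hq ((heq n).trans (hs n) hr hq hrq)

theorem IsStable.central_mul {z : H →L[ℂ] H} (hz : z ∈ centralProjections M)
    (h : IsStable M r) : IsStable M (z * r) := by
  obtain ⟨s, hs, ho, hle, heq⟩ := h
  have hc : ∀ n, s n * z = z * s n := fun n => (commute_of_mem_centre hz.1 (hs n).1).symm.eq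
  refine ⟨fun n => z * s n, fun n => central_mul_mem_projections hz (hs n), fun m n hmn => ?_,
    fun n => ?_, fun n => (heq n).central_mul hz⟩
  · change z * s m * (z * s n) = 0
    rw [mul_assoc, ← mul_assoc (s m), hc, mul_assoc z (s m), ho hmn]; simp
  · change z * r * (z * s n) = z * s n
    rw [← hc, mul_assoc, ← mul_assoc r, hle, hc, ← mul_assoc, hz.2.isIdempotentElem.eq]

/-- Orthogonal sums of stable projections are stable. -/
theorem IsStable.sum {ι : Type*} {r : ι → H →L[ℂ] H} {R : H →L[ℂ] H}
    (hr : ∀ i, r i ∈ projections M) (ho : Pairwise fun i j => r i * r j = 0)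
    (hR : SOTSum r R) (h : ∀ i, IsStable M (r i)) : IsStable M R := by
  choose s hs hso hle heq using h
  have hle' : ∀ i n, s i n * r i = s i n := fun i n => projSub_mul (hr i).2 (hs i n).2 (hle i n)
  have hoo : ∀ i j m n, i ≠ j → s i m * s j n = 0 := fun i j m n hij => by
    rw [← hle' i, ← hle j, mul_assoc, ← mul_assoc (r i), ho hij]; simp
  choose S hS hSp hSs using fun n => exists_sum_projections (fun i => (hs i n).2)
    fun i j hij => hoo i j n n hij
  have hRr := (hR.isStarProjection (fun i => (hr i).2) ho).2
  refine ⟨S, fun n => ⟨(hS n).mem fun i => (hs i n).1, hSp n⟩, fun m n hmn => ?_, fun n => ?_,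
    fun n => ?_⟩
  · refine ((hS n).mul_left (S m)).unique ?_
    have : ∀ i, S m * s i n = 0 := fun i => by
      rw [(hS m).mul_eq_of_orthogonal i fun j hj => hoo j i m n hj, hso i hmn]
    simpa only [this] using SOTSum.zero
  · refine ((hS n).mul_left R).unique ?_
    have : ∀ i, R * s i n = s i n := fun i => by rw [← hle i, ← mul_assoc, hRr]
    simpa only [this] using hS n
  · obtain ⟨V, hV, h1, h2, -⟩ := MvNEquiv.sum (fun i => hs i n) hr
      (fun i j hij => hoo i j n n hij) ho (hS n) hR fun i => heq i n
    exact ⟨V, hV, h1, h2⟩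

/-- An infinite projection dominates a nonzero stable one: the orbit of the complement of a
proper equivalent subprojection adds up to a stable projection, by a bijection `ℕ ≃ ℕ × ℕ`. -/
theorem exists_isStable_of_infinite (hp : p ∈ projections M) (h : p ∉ finiteProjections M) :
    ∃ r ∈ projections M, r ≠ 0 ∧ p * r = r ∧ IsStable M r := by
  have : ∃ q ∈ projections M, MvNEquiv M p q ∧ q ≤ p ∧ p ≠ q := by
    by_contra hcon
    push Not at hcon
    exact h ⟨hp, hcon⟩
  obtain ⟨q, hq, hpq, hle, hne⟩ := this
  have hpq' : p * q = q := (hq.2.le_iff_mul_eq_right hp.2).1 hle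
  have hqp' : q * p = q := projSub_mul hp.2 hq.2 hpq'
  obtain ⟨x, hx, x1, x2, x3, x4⟩ := hpq.exists hp hq
  have hxq : star x * q = star x := by
    have := congrArg star x4
    rwa [star_mul, hq.2.isSelfAdjoint.star_eq] at this
  have hxp : star x * p = star x := by rw [← hxq, mul_assoc, hqp']
  have hs₀ : p - q ∈ projections M := ⟨sub_mem hp.1 hq.1, isStarProjection_sub hq.2 hp.2 hpq'⟩
  obtain ⟨s, hs0, -, hs2, hs3, hs4, hs5⟩ := exists_orthogonal_orbit (x := x) (p := p) hx x1
    (by rw [← x4, ← mul_assoc, hpq']) hs₀ (by rw [mul_sub, hpq', hp.2.isIdempotentElem.eq])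
    (by rw [mul_sub, hxp, hxq, sub_self])
  obtain ⟨r, hr, hrp, hrs⟩ := exists_sum_projections (fun n => (hs2 n).2) hs5
  have hpair : ∀ {k l i j}, (k, i) ≠ (l, j) → s (Nat.pair k i) * s (Nat.pair l j) = 0 :=
    fun h => hs5 fun h' => h (by simpa using congrArg Nat.unpair h')
  have ho : ∀ k, Pairwise fun i j => s (Nat.pair k i) * s (Nat.pair k j) = 0 :=
    fun k i j hij => hpair (by simpa using hij)
  choose t ht htp hts using fun k => exists_sum_projections
    (fun i => (hs2 (Nat.pair k i)).2) (ho k)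
  refine ⟨r, ⟨hr.mem fun n => (hs2 n).1, hrp⟩, ?_, ?_, t,
    fun n => ⟨(ht n).mem fun i => (hs2 _).1, htp n⟩, fun m n hmn => ?_, fun n => ?_, fun n => ?_⟩
  · intro hr0
    have := hrs 0
    rw [hr0, zero_mul, hs0] at this
    exact hne (sub_eq_zero.1 this.symm)
  · exact (hr.mul_left p).unique (by simpa only [hs4] using hr)
  · refine ((ht n).mul_left (t m)).unique ?_
    have : ∀ i, t m * s (Nat.pair n i) = 0 := fun i => by
      rw [(ht m).mul_eq_of_orthogonal i fun j _ => hpair (by simp [hmn]), hpair (by simp [hmn])]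
    simpa only [this] using SOTSum.zero
  · exact ((ht n).mul_left r).unique (by simpa only [hrs] using ht n)
  · obtain ⟨V, hV, h1, h2, -⟩ := MvNEquiv.sum (fun i => hs2 (Nat.pair n i)) hs2 (ho n) hs5
      (ht n) hr fun i => (hs3 _).symm.trans (hs2 _) hs₀ (hs2 _) (hs3 _)
    exact ⟨V, hV, h1, h2⟩

/-- Zorn's lemma for orthogonal families of operators with a given property. -/
theorem exists_maximal_orthogonal (P : (H →L[ℂ] H) → Prop) :
    ∃ S : Set (H →L[ℂ] H), (∀ s ∈ S, P s) ∧ S.Pairwise (fun a b => a * b = 0) ∧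
      ∀ a, P a → (∀ s ∈ S, s * a = 0 ∧ a * s = 0) → a ∈ S := by
  obtain ⟨S, hS⟩ := zorn_subset {S : Set (H →L[ℂ] H) | (∀ s ∈ S, P s) ∧
    S.Pairwise (fun a b => a * b = 0)} (by
      intro c hc hch
      refine ⟨⋃₀ c, ⟨?_, (Set.pairwise_sUnion hch.directedOn).2 fun s hs => (hc hs).2⟩,
        fun s hs => Set.subset_sUnion_of_mem hs⟩
      rintro s ⟨t, ht, hst⟩
      exact (hc ht).1 s hst)
  refine ⟨S, hS.prop.1, hS.prop.2, fun a ha h => ?_⟩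
  have : insert a S ∈ {S : Set (H →L[ℂ] H) | (∀ s ∈ S, P s) ∧
      S.Pairwise (fun a b => a * b = 0)} :=
    ⟨by rintro s (rfl | hs); exacts [ha, hS.prop.1 s hs],
      hS.prop.2.insert fun b hb _ => ⟨(h b hb).2, (h b hb).1⟩⟩
  exact hS.le_of_ge this (Set.subset_insert a S) (Set.mem_insert a S)

/-- A stable projection absorbs every projection under its central support: exhaust `q` by a
maximal orthogonal family of projections subequivalent to `r`; the family is countable, so its
members fit into different copies of `r` inside `r`. -/
theorem subequiv_of_isStable (hσ : IsSigmaFinite M) (hr : r ∈ projections M)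
    (hst : IsStable M r) (hq : q ∈ projections M) (hqc : q * centralSupport M r = q) :
    Subequiv M q r := by
  obtain ⟨S, hS, hSo, hmax⟩ := exists_maximal_orthogonal fun a : H →L[ℂ] H =>
    (a ∈ projections M ∧ a ≠ 0) ∧ q * a = a ∧ Subequiv M a r
  have hSo' : Pairwise fun i j : S => (i : H →L[ℂ] H) * j = 0 :=
    fun i j hij => hSo i.2 j.2 fun h => hij (Subtype.ext h)
  have hSp : ∀ i : S, (i : H →L[ℂ] H) ∈ projections M := fun i => (hS i i.2).1.1
  obtain ⟨Q, hQ, hQp, hQs⟩ := exists_sum_projections (fun i => (hSp i).2) hSo'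
  have hQM : Q ∈ M := hQ.mem fun i => (hSp i).1
  have hqQ : q * Q = Q := (hQ.mul_left q).unique
    (by simpa only [fun i : S => (hS i i.2).2.1] using hQ)
  have hQeq : q = Q := by
    by_contra hne
    have hd : q - Q ∈ projections M :=
      ⟨sub_mem hq.1 hQM, isStarProjection_sub hQp hq.2 hqQ⟩
    have hQq : Q * q = Q := projSub_mul hq.2 hQp hqQ
    have h1 : (q - Q) * centralSupport M r ≠ 0 := by
      have hQc : Q * centralSupport M r = Q := by
        conv_lhs => rw [← hQq, mul_assoc, hqc, hQq]
      rw [sub_mul, hqc, hQc]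
      exact sub_ne_zero.2 hne
    obtain ⟨x, hx, hx0⟩ : ∃ x ∈ M, (q - Q) * x * r ≠ 0 := by
      by_contra hcon
      push Not at hcon
      exact h1 (mul_centralSupport_eq_zero_of_forall hr.1 hcon)
    obtain ⟨a, ha, s, hs, hs0, hsa, hra, hds⟩ := exists_equiv_subprojections (q := q - Q) hr
      (mul_mem (mul_mem hd.1 hx) hr.1) hx0 (by rw [mul_assoc, hr.2.isIdempotentElem.eq])
      (by rw [← mul_assoc, ← mul_assoc, hd.2.isIdempotentElem.eq])
    have hQs0 : Q * s = 0 := by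
      rw [← hds, ← mul_assoc, mul_sub, hQq, hQp.isIdempotentElem.eq, sub_self, zero_mul]
    have hqs : q * s = s := by
      have := hds
      rwa [sub_mul, hQs0, sub_zero] at this
    have hsS : s ∈ S := hmax s ⟨⟨hs, hs0⟩, hqs, a, ha, hsa, hra⟩ fun t ht => by
      have h2 : t * Q = t := projSub_mul hQp (hSp ⟨t, ht⟩).2 (hQs ⟨t, ht⟩)
      have h3 : t * s = 0 := by rw [← h2, mul_assoc, hQs0, mul_zero]
      exact ⟨h3, orth_symm (hSp ⟨t, ht⟩).2 hs.2 h3⟩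
    exact hs0 ((hQs ⟨s, hsS⟩).symm.trans hQs0)
  have hcount : S.Countable := hσ S (fun a ha => (hS a ha).1) hSo
  obtain ⟨f, hf⟩ := hcount.exists_injective_nat
  obtain ⟨s, hs, hso, hle, heq⟩ := hst
  have : ∀ i : S, ∃ t ∈ projections M, MvNEquiv M (i : H →L[ℂ] H) t ∧ s (f i) * t = t := by
    intro i
    obtain ⟨a, ha, hia, hra⟩ := (hS i i.2).2.2
    obtain ⟨v, hv, v1, v2⟩ := (heq (f i)).symm
    obtain ⟨c1, c2, c3⟩ := conj_subprojection hv v1 ha hra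
    exact ⟨_, c1, hia.trans (hSp i) ha c1 c2, by rw [← v2]; exact c3⟩
  choose t ht hit hst using this
  have hts : ∀ i, t i * s (f i) = t i := fun i => projSub_mul (hs _).2 (ht i).2 (hst i)
  have hto : Pairwise fun i j => t i * t j = 0 := fun i j hij => by
    change t i * t j = 0
    rw [← hts i, ← hst j, mul_assoc, ← mul_assoc (s _), hso fun h => hij (hf h)]; simp
  obtain ⟨T, hT, hTp, -⟩ := exists_sum_projections (fun i => (ht i).2) hto
  obtain ⟨V, hV, h1, h2, -⟩ := MvNEquiv.sum hSp ht hSo' hto hQ hT hit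
  refine ⟨T, ⟨hT.mem fun i => (ht i).1, hTp⟩, hQeq ▸ ⟨V, hV, h1, h2⟩, ?_⟩
  refine (hT.mul_left r).unique ?_
  have : ∀ i, r * t i = t i := fun i => by rw [← hst i, ← mul_assoc, hle]
  simpa only [this] using hT

/-- Stable projections with the same central support are equivalent. -/
theorem mvnEquiv_of_isStable (hσ : IsSigmaFinite M) (hp : p ∈ projections M)
    (hq : q ∈ projections M) (hps : IsStable M p) (hqs : IsStable M q)
    (hpc : p * centralSupport M q = p) (hqc : q * centralSupport M p = q) : MvNEquiv M p q :=
  Subequiv.antisymm hp hq (subequiv_of_isStable hσ hq hqs hp hpc)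
    (subequiv_of_isStable hσ hp hps hq hqc)

/-- In a σ-finite algebra a properly infinite projection is stable: the sum of a maximal
orthogonal family of stable subprojections is stable with the same central support. -/
theorem isStable_of_isProperlyInfinite (hσ : IsSigmaFinite M)
    (hp : IsProperlyInfiniteProjection M p) : IsStable M p := by
  obtain ⟨hpM, hinf⟩ := hp
  obtain ⟨S, hS, hSo, hmax⟩ := exists_maximal_orthogonal fun a : H →L[ℂ] H =>
    a ∈ projections M ∧ a ≠ 0 ∧ p * a = a ∧ IsStable M a
  have hSo' : Pairwise fun i j : S => (i : H →L[ℂ] H) * j = 0 :=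
    fun i j hij => hSo i.2 j.2 fun h => hij (Subtype.ext h)
  have hSp : ∀ i : S, (i : H →L[ℂ] H) ∈ projections M := fun i => (hS i i.2).1
  obtain ⟨R, hR, hRp, hRs⟩ := exists_sum_projections (fun i => (hSp i).2) hSo'
  have hRM : R ∈ projections M := ⟨hR.mem fun i => (hSp i).1, hRp⟩
  have hpR : p * R = R := (hR.mul_left p).unique
    (by simpa only [fun i : S => (hS i i.2).2.2.1] using hR)
  have hRst : IsStable M R := IsStable.sum hSp hSo' hR fun i => (hS i i.2).2.2.2
  set c := centralSupport M R with hc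
  have hcc : c ∈ centre M := centralSupport_mem_centre M R
  have hcp : IsStarProjection c := isStarProjection_centralSupport M R
  have hcR : c * R = R := centralSupport_mul M R
  have hRc : R * c = R := projSub_mul hcp hRp hcR
  have hz : 1 - c ∈ centralProjections M := ⟨sub_mem (one_mem _) hcc, hcp.one_sub⟩
  have h0 : (1 - c) * p = 0 := by
    by_contra hne
    obtain ⟨t, ht, ht0, htp, htst⟩ := exists_isStable_of_infinite
      (central_mul_mem_projections hz hpM) (hinf _ hz hne)
    have hRt : R * t = 0 := by
      rw [← htp, ← mul_assoc, ← mul_assoc, mul_sub, hRc, mul_one, sub_self, zero_mul, zero_mul]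
    have hpt : p * t = t := by
      rw [← htp, ← mul_assoc, ← mul_assoc, (commute_of_mem_centre hz.1 hpM.1).symm.eq,
        mul_assoc (1 - c) p p, hpM.2.isIdempotentElem.eq]
    have htS : t ∈ S := hmax t ⟨ht, ht0, hpt, htst⟩ fun s hs => by
      have h2 : s * R = s := projSub_mul hRp (hSp ⟨s, hs⟩).2 (hRs ⟨s, hs⟩)
      have h3 : s * t = 0 := by rw [← h2, mul_assoc, hRt, mul_zero]
      exact ⟨h3, orth_symm (hSp ⟨s, hs⟩).2 ht.2 h3⟩
    exact ht0 ((hRs ⟨t, htS⟩).symm.trans hRt)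
  have hpc : p * c = p := by
    rw [(commute_of_mem_centre hcc hpM.1).symm.eq]
    rw [sub_mul, one_mul, sub_eq_zero] at h0
    exact h0.symm
  have := Subequiv.antisymm hpM hRM (subequiv_of_isStable hσ hRM hRst hpM hpc)
    ⟨R, hRM, MvNEquiv.refl hRM, hpR⟩
  exact hRst.of_equiv hRM hpM this.symm

/-- If the identity is stable, it is an orthogonal sum of projections equivalent to it. -/
theorem exists_isEquivPartition (h : IsStable M 1) : ∃ p, IsEquivPartition M p := by
  obtain ⟨s, hs, hso, -, heq⟩ := h
  have h1 : (1 : H →L[ℂ] H) ∈ projections M := ⟨one_mem _, IsStarProjection.one _⟩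
  obtain ⟨S, hS, hSp, hSs⟩ := exists_sum_projections (fun n => (hs n).2) hso
  have hSM : S ∈ projections M := ⟨hS.mem fun n => (hs n).1, hSp⟩
  obtain ⟨v, hv, v1, v2, v3, v4⟩ := (Subequiv.antisymm hSM h1
    ⟨S, hSM, MvNEquiv.refl hSM, one_mul _⟩ ⟨s 0, hs 0, (heq 0).symm, hSs 0⟩).exists hSM h1
  have hc := fun n => conj_subprojection hv v1 (hs n) (hSs n)
  refine ⟨fun n => v * s n * star v, fun n => (hc n).1, fun m n hmn => ?_, fun n =>
    (hc n).2.1.symm.trans (hc n).1 (hs n) h1 (heq n), ?_⟩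
  · calc v * s m * star v * (v * s n * star v)
        = v * (s m * ((star v * v) * s n)) * star v := by noncomm_ring
      _ = 0 := by rw [v1, hSs, hso hmn, mul_zero, zero_mul]
  · have := (hS.mul_left v).mul_right (star v)
    rw [v3, v2] at this
    exact this

end Comparison

/-! ### Spectral projections of a self-adjoint operator -/

section Spectral

variable {x : H →L[ℂ] H}

theorem re_inner_algebraMap (t : ℝ) (ξ : H) :
    RCLike.re (inner ℂ ((algebraMap ℝ (H →L[ℂ] H) t) ξ) ξ) = t * ‖ξ‖ ^ 2 := by
  have : (algebraMap ℝ (H →L[ℂ] H) t) ξ = (t : ℂ) • ξ := by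
    rw [Algebra.algebraMap_eq_smul_one]; simp
  rw [this, inner_smul_left, inner_self_eq_norm_sq_to_K]
  simp [← Complex.ofReal_pow]

theorem isSelfAdjoint_algebraMap_sub (hx : IsSelfAdjoint x) (t : ℝ) :
    IsSelfAdjoint (algebraMap ℝ (H →L[ℂ] H) t - x) :=
  (IsSelfAdjoint.algebraMap _ (IsSelfAdjoint.all t)).sub hx

theorem isStarProjection_spectralBelow (x : H →L[ℂ] H) (t : ℝ) :
    IsStarProjection (spectralBelow x t) :=
  isStarProjection_leftSupport _

theorem commute_spectralBelow {y : H →L[ℂ] H} (h : Commute y x) (h' : Commute (star y) x)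
    (t : ℝ) : Commute y (spectralBelow x t) := by
  have key : ∀ w : H →L[ℂ] H, Commute w x →
      Commute w ((algebraMap ℝ (H →L[ℂ] H) t - x)⁺) := fun w hw => by
    rw [CFC.posPart_def]
    exact (Commute.cfcₙ_real ((Algebra.commute_algebraMap_left t w).sub_left hw.symm) _).symm
  exact commute_leftSupport (key y h) (key _ h')

/-- The operator `t - x` agrees with its positive part on the range of `e^x((-∞, t))` and with
the negative of its negative part on the kernel. -/
theorem inner_le_of_spectralBelow (hx : IsSelfAdjoint x) (t : ℝ) {ξ : H}
    (h : spectralBelow x t ξ = ξ) : RCLike.re (inner ℂ (x ξ) ξ) ≤ t * ‖ξ‖ ^ 2 := by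
  set y := algebraMap ℝ (H →L[ℂ] H) t - x with hy
  have hys := isSelfAdjoint_algebraMap_sub hx t
  have h1 : y⁻ * spectralBelow x t = 0 := mul_leftSupport_eq_zero (CFC.negPart_mul_posPart y)
  have h2 : y⁻ ξ = 0 := by
    rw [← h]; exact congrArg (fun T : H →L[ℂ] H => T ξ) h1
  have h3 : y ξ = y⁺ ξ := by
    conv_lhs => rw [← CFC.posPart_sub_negPart y hys]
    rw [sub_apply, h2, sub_zero]
  have h4 := ((ContinuousLinearMap.nonneg_iff_isPositive _).1
    (CFC.posPart_nonneg y)).re_inner_nonneg_left ξ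
  rw [← h3, hy, sub_apply, inner_sub_left, map_sub, re_inner_algebraMap] at h4
  linarith

theorem le_inner_of_spectralBelow (hx : IsSelfAdjoint x) (t : ℝ) {ξ : H}
    (h : spectralBelow x t ξ = 0) : t * ‖ξ‖ ^ 2 ≤ RCLike.re (inner ℂ (x ξ) ξ) := by
  set y := algebraMap ℝ (H →L[ℂ] H) t - x with hy
  have hys := isSelfAdjoint_algebraMap_sub hx t
  have h1 : y⁺ * spectralBelow x t = y⁺ := by
    have := congrArg star (leftSupport_mul y⁺)
    rwa [star_mul, (isStarProjection_leftSupport _).isSelfAdjoint.star_eq,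
      (CFC.posPart_nonneg y).isSelfAdjoint.star_eq] at this
  have h2 : y⁺ ξ = 0 := by
    rw [← h1, mul_apply_eq_comp, h, map_zero]
  have h3 : y ξ = - y⁻ ξ := by
    conv_lhs => rw [← CFC.posPart_sub_negPart y hys]
    rw [sub_apply, h2, zero_sub]
  have h4 := ((ContinuousLinearMap.nonneg_iff_isPositive _).1
    (CFC.negPart_nonneg y)).re_inner_nonneg_left ξ
  have h6 : RCLike.re (inner ℂ (y ξ) ξ) ≤ 0 := by
    rw [h3, inner_neg_left, map_neg]; linarith
  rw [hy, sub_apply, inner_sub_left, map_sub, re_inner_algebraMap] at h6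
  linarith

theorem commute_spectralBelow_self (hx : IsSelfAdjoint x) (t : ℝ) :
    Commute x (spectralBelow x t) :=
  commute_spectralBelow (Commute.refl x) (by rw [hx.star_eq]) t

theorem commute_spectralBelow_spectralBelow (hx : IsSelfAdjoint x) (s t : ℝ) :
    Commute (spectralBelow x s) (spectralBelow x t) := by
  have h := (commute_spectralBelow_self hx s).symm
  exact commute_spectralBelow h
    (by rwa [(isStarProjection_spectralBelow x s).isSelfAdjoint.star_eq]) t

theorem spectralBelow_mono (hx : IsSelfAdjoint x) {s t : ℝ} (hst : s ≤ t) :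
    spectralBelow x t * spectralBelow x s = spectralBelow x s := by
  rcases hst.eq_or_lt with rfl | hst
  · exact (isStarProjection_spectralBelow x s).isIdempotentElem.eq
  have hs := (isStarProjection_spectralBelow x s).isIdempotentElem.eq
  have ht := (isStarProjection_spectralBelow x t).isIdempotentElem.eq
  have hc := (commute_spectralBelow_spectralBelow hx s t).eq
  -- On the range of `(1 - P_t) P_s` both `x ≤ s` and `x ≥ t` hold as quadratic forms.
  ext ξ
  set η := spectralBelow x s ξ - spectralBelow x t (spectralBelow x s ξ) with hη
  have e1 : spectralBelow x s (spectralBelow x s ξ) = spectralBelow x s ξ :=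
    congrArg (fun T : H →L[ℂ] H => T ξ) hs
  have e2 : ∀ ζ, spectralBelow x t (spectralBelow x t ζ) = spectralBelow x t ζ :=
    fun ζ => congrArg (fun T : H →L[ℂ] H => T ζ) ht
  have e3 : ∀ ζ, spectralBelow x s (spectralBelow x t ζ) =
    spectralBelow x t (spectralBelow x s ζ) := fun ζ => congrArg (fun T : H →L[ℂ] H => T ζ) hc
  have h1 := inner_le_of_spectralBelow hx s (ξ := η) (by rw [hη, map_sub, e3, e1])
  have h2 := le_inner_of_spectralBelow hx t (ξ := η) (by rw [hη, map_sub, e2, sub_self])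
  have h3 : ‖η‖ ^ 2 = 0 := by nlinarith [sq_nonneg ‖η‖]
  have h4 : η = 0 := by simpa using h3
  exact (sub_eq_zero.1 h4).symm

theorem abs_inner_apply_le (x : H →L[ℂ] H) (ξ : H) :
    |RCLike.re (inner ℂ (x ξ) ξ)| ≤ ‖x‖ * ‖ξ‖ ^ 2 := by
  refine (RCLike.abs_re_le_norm _).trans ((norm_inner_le_norm _ _).trans ?_)
  rw [pow_two, ← mul_assoc]
  gcongr
  exact x.le_opNorm ξ

theorem spectralBelow_eq_zero (hx : IsSelfAdjoint x) {t : ℝ} (ht : t < -‖x‖) :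
    spectralBelow x t = 0 := by
  ext ξ
  set η := spectralBelow x t ξ with hη
  have h1 := inner_le_of_spectralBelow hx t (ξ := η)
    (congrArg (fun T : H →L[ℂ] H => T ξ) (isStarProjection_spectralBelow x t).isIdempotentElem.eq)
  have h2 := neg_le_of_abs_le (abs_inner_apply_le x η)
  have h3 : ‖η‖ ^ 2 = 0 := by nlinarith [sq_nonneg ‖η‖]
  simpa using h3

theorem spectralBelow_eq_one (hx : IsSelfAdjoint x) {t : ℝ} (ht : ‖x‖ < t) :
    spectralBelow x t = 1 := by
  ext ξ
  set η := ξ - spectralBelow x t ξ with hη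
  have h1 := le_inner_of_spectralBelow hx t (ξ := η) (by
    rw [hη, map_sub, sub_eq_zero]
    exact (congrArg (fun T : H →L[ℂ] H => T ξ)
      (isStarProjection_spectralBelow x t).isIdempotentElem.eq).symm)
  have h2 := le_of_abs_le (abs_inner_apply_le x η)
  have h3 : ‖η‖ ^ 2 = 0 := by nlinarith [sq_nonneg ‖η‖]
  have h4 : η = 0 := by simpa using h3
  exact (sub_eq_zero.1 h4).symm

theorem isStarProjection_spectralIco (hx : IsSelfAdjoint x) {a b : ℝ} (hab : a ≤ b) :
    IsStarProjection (spectralIco x a b) :=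
  isStarProjection_sub (isStarProjection_spectralBelow x a) (isStarProjection_spectralBelow x b)
    (spectralBelow_mono hx hab)

theorem commute_spectralIco {y : H →L[ℂ] H} (h : Commute y x) (h' : Commute (star y) x)
    (a b : ℝ) : Commute y (spectralIco x a b) :=
  (commute_spectralBelow h h' b).sub_right (commute_spectralBelow h h' a)

theorem spectralIco_mul_spectralIco (hx : IsSelfAdjoint x) {a b c d : ℝ} (hab : a ≤ b)
    (hbc : b ≤ c) (hcd : c ≤ d) : spectralIco x a b * spectralIco x c d = 0 := by
  have h : ∀ {s t : ℝ}, s ≤ t → spectralBelow x s * spectralBelow x t = spectralBelow x s :=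
    fun hst => projSub_mul (isStarProjection_spectralBelow x _)
      (isStarProjection_spectralBelow x _) (spectralBelow_mono hx hst)
  rw [spectralIco, spectralIco, sub_mul, mul_sub, mul_sub, h (hbc.trans hcd), h hbc,
    h ((hab.trans hbc).trans hcd), h (hab.trans hbc)]
  simp

/-- The operator `x` is within `b - a` of the scalar `a` on the range of `e^x([a, b))`. -/
theorem norm_mul_spectralIco_sub_le (hx : IsSelfAdjoint x) {a b : ℝ} (hab : a ≤ b) :
    ‖x * spectralIco x a b - (a : ℂ) • spectralIco x a b‖ ≤ b - a := by
  set E := spectralIco x a b with hE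
  have hEp : IsStarProjection E := isStarProjection_spectralIco hx hab
  have hxE : Commute x E := commute_spectralIco (Commute.refl x) (by rw [hx.star_eq]) a b
  set T := x * E - (a : ℂ) • E with hT
  have hTs : IsSelfAdjoint T := by
    have h1 : IsSelfAdjoint (x * E) := (hx.commute_iff hEp.isSelfAdjoint).1 hxE
    have h2 : IsSelfAdjoint ((a : ℂ) • E) :=
      IsSelfAdjoint.smul (by simp [IsSelfAdjoint]) hEp.isSelfAdjoint
    exact h1.sub h2
  have hPE : spectralBelow x b * E = E := by
    rw [hE, spectralIco, mul_sub, spectralBelow_mono hx hab,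
      (isStarProjection_spectralBelow x b).isIdempotentElem.eq]
  have hPE' : spectralBelow x a * E = 0 := by
    rw [hE, spectralIco, mul_sub, projSub_mul (isStarProjection_spectralBelow x b)
      (isStarProjection_spectralBelow x a) (spectralBelow_mono hx hab),
      (isStarProjection_spectralBelow x a).isIdempotentElem.eq, sub_self]
  have hquad : ∀ ξ, RCLike.re (inner ℂ (T ξ) ξ) =
      RCLike.re (inner ℂ (x (E ξ)) (E ξ)) - a * ‖E ξ‖ ^ 2 := by
    intro ξ
    have h1 : inner ℂ (x (E ξ)) ξ = inner ℂ (x (E ξ)) (E ξ) := by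
      rw [← ContinuousLinearMap.adjoint_inner_left, ← ContinuousLinearMap.star_eq_adjoint,
        hEp.isSelfAdjoint.star_eq]
      congr 1
      have h2 : E * (x * E) = x * E := by
        rw [← mul_assoc, ← hxE.eq, mul_assoc, hEp.isIdempotentElem.eq]
      exact (congrArg (fun T : H →L[ℂ] H => T ξ) h2).symm
    have h3 : T ξ = x (E ξ) - (a : ℂ) • E ξ := rfl
    rw [h3, inner_sub_left, map_sub, h1, inner_smul_left, ← inner_apply_eq_norm_sq hEp]
    simp
  have hb : ∀ ξ, RCLike.re (inner ℂ (x (E ξ)) (E ξ)) ≤ b * ‖E ξ‖ ^ 2 := fun ξ =>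
    inner_le_of_spectralBelow hx b (congrArg (fun T : H →L[ℂ] H => T ξ) hPE)
  have ha : ∀ ξ, a * ‖E ξ‖ ^ 2 ≤ RCLike.re (inner ℂ (x (E ξ)) (E ξ)) := fun ξ =>
    le_inner_of_spectralBelow hx a (congrArg (fun T : H →L[ℂ] H => T ξ) hPE')
  have hEn : ∀ ξ, ‖E ξ‖ ^ 2 ≤ ‖ξ‖ ^ 2 := fun ξ => by
    gcongr
    simpa using ContinuousLinearMap.le_of_opNorm_le _ hEp.norm_le ξ
  have hpos : 0 ≤ T := by
    rw [ContinuousLinearMap.nonneg_iff_isPositive, ContinuousLinearMap.isPositive_def]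
    refine ⟨hTs.isSymmetric, fun ξ => ?_⟩
    rw [ContinuousLinearMap.reApplyInnerSelf_apply, hquad]
    linarith [ha ξ]
  rw [CStarAlgebra.norm_le_iff_le_algebraMap T (sub_nonneg.2 hab) hpos,
    ContinuousLinearMap.le_def, ContinuousLinearMap.isPositive_def]
  refine ⟨((IsSelfAdjoint.algebraMap _ (IsSelfAdjoint.all (b - a))).sub hTs).isSymmetric,
    fun ξ => ?_⟩
  rw [ContinuousLinearMap.reApplyInnerSelf_apply, sub_apply, inner_sub_left, map_sub,
    re_inner_algebraMap, hquad]
  nlinarith [hb ξ, hEn ξ]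

/-- An operator commuting with a finite partition of unity by projections is bounded by the
largest norm among its corners. -/
theorem norm_le_of_partition {κ : Type*} [Fintype κ] {e : κ → H →L[ℂ] H} {T : H →L[ℂ] H}
    (he : ∀ i, IsStarProjection (e i)) (hsum : ∑ i, e i = 1) (hT : ∀ i, Commute T (e i))
    {c : ℝ} (hc0 : 0 ≤ c) (hc : ∀ i, ‖T * e i‖ ≤ c) : ‖T‖ ≤ c := by
  have hpyth : ∀ ξ, ‖ξ‖ ^ 2 = ∑ i, ‖e i ξ‖ ^ 2 := by
    intro ξ
    simp only [← inner_apply_eq_norm_sq (he _)]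
    rw [← map_sum, ← sum_inner, ← sum_apply, hsum, one_apply_eq_self,
      inner_self_eq_norm_sq]
  refine ContinuousLinearMap.opNorm_le_bound _ hc0 fun ξ => ?_
  refine abs_le_of_sq_le_sq' ?_ (by positivity) |>.2
  rw [hpyth (T ξ), mul_pow, hpyth ξ, Finset.mul_sum]
  refine Finset.sum_le_sum fun i _ => ?_
  have h1 : e i (T ξ) = (T * e i) (e i ξ) := by
    have : e i * T = T * e i * e i := by
      rw [mul_assoc, (he i).isIdempotentElem.eq, (hT i).eq]
    exact congrArg (fun S : H →L[ℂ] H => S ξ) this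
  rw [h1, ← mul_pow]
  gcongr
  exact ContinuousLinearMap.le_of_opNorm_le _ (hc i) _

end Spectral

/-! ### Dyadic boxes -/

section Boxes

/-- The product of a list of commuting projections is a projection. -/
theorem isStarProjection_list_prod {l : List (H →L[ℂ] H)} (hl : ∀ a ∈ l, IsStarProjection a)
    (hc : ∀ a ∈ l, ∀ b ∈ l, Commute a b) : IsStarProjection l.prod := by
  induction l with
  | nil => simp
  | cons a l ih =>
    rw [List.prod_cons]
    refine isStarProjection_mul (hl a (by simp)) (ih (fun b hb => hl b (by simp [hb]))
      fun b hb c hc' => hc b (by simp [hb]) c (by simp [hc'])) ?_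
    exact Commute.list_prod_right l a fun b hb => hc a (by simp) b (by simp [hb])

theorem mul_list_prod_of_mem {l : List (H →L[ℂ] H)} (hl : ∀ a ∈ l, IsStarProjection a)
    (hc : ∀ a ∈ l, ∀ b ∈ l, Commute a b) {a : H →L[ℂ] H} (ha : a ∈ l) :
    a * l.prod = l.prod := by
  induction l with
  | nil => simp at ha
  | cons b l ih =>
    rw [List.prod_cons]
    rcases List.mem_cons.1 ha with rfl | h
    · rw [← mul_assoc, (hl a (by simp)).isIdempotentElem.eq]
    · rw [← mul_assoc, (hc a ha b (by simp)).eq, mul_assoc,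
        ih (fun b hb => hl b (by simp [hb]))
          (fun b hb c hc' => hc b (by simp [hb]) c (by simp [hc'])) h]

theorem sum_list_prod_ofFn {R κ : Type*} [Ring R] [Fintype κ] {n : ℕ} (E : Fin n → κ → R) :
    ∑ k : Fin n → κ, (List.ofFn fun j => E j (k j)).prod =
      (List.ofFn fun j => ∑ i, E j i).prod := by
  induction n with
  | zero => simp
  | succ n ih =>
    rw [← (Fin.consEquiv fun _ => κ).sum_comp, Fintype.sum_prod_type]
    simp only [List.ofFn_succ, List.prod_cons, Fin.consEquiv_apply, Fin.cons_zero, Fin.cons_succ]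
    rw [← ih, Finset.sum_mul_sum]

variable {n : ℕ} {α : Fin n → H →L[ℂ] H}

theorem commute_spectralIco_spectralIco (hα : ∀ j, IsSelfAdjoint (α j))
    (hc : ∀ i j, Commute (α i) (α j)) (i j : Fin n) (a b c d : ℝ) :
    Commute (spectralIco (α i) a b) (spectralIco (α j) c d) := by
  have h1 : ∀ t, Commute (spectralBelow (α i) t) (α j) := fun t =>
    (commute_spectralBelow (hc j i) (by rw [(hα j).star_eq]; exact hc j i) t).symm
  have h2 : ∀ t, Commute (spectralBelow (α i) t) (spectralIco (α j) c d) := fun t =>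
    commute_spectralIco (h1 t)
      (by rw [(isStarProjection_spectralBelow _ _).isSelfAdjoint.star_eq]; exact h1 t) _ _
  exact (h2 b).sub_left (h2 a)

theorem commute_spectralBox {y : H →L[ℂ] H} (h : ∀ j, Commute y (α j))
    (h' : ∀ j, Commute (star y) (α j)) (a b : Fin n → ℝ) : Commute y (spectralBox α a b) := by
  refine Commute.list_prod_right _ _ fun c hc => ?_
  obtain ⟨j, rfl⟩ := (List.mem_ofFn' _ _).1 hc
  exact commute_spectralIco (h j) (h' j) _ _

theorem isStarProjection_spectralBox (hα : ∀ j, IsSelfAdjoint (α j))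
    (hc : ∀ i j, Commute (α i) (α j)) {a b : Fin n → ℝ} (hab : ∀ j, a j ≤ b j) :
    IsStarProjection (spectralBox α a b) := by
  refine isStarProjection_list_prod (fun p hp => ?_) fun p hp q hq => ?_
  · obtain ⟨j, rfl⟩ := (List.mem_ofFn' _ _).1 hp
    exact isStarProjection_spectralIco (hα j) (hab j)
  · obtain ⟨i, rfl⟩ := (List.mem_ofFn' _ _).1 hp
    obtain ⟨j, rfl⟩ := (List.mem_ofFn' _ _).1 hq
    exact commute_spectralIco_spectralIco hα hc _ _ _ _ _ _

theorem spectralIco_mul_spectralBox (hα : ∀ j, IsSelfAdjoint (α j))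
    (hc : ∀ i j, Commute (α i) (α j)) {a b : Fin n → ℝ} (hab : ∀ j, a j ≤ b j) (j : Fin n) :
    spectralIco (α j) (a j) (b j) * spectralBox α a b = spectralBox α a b := by
  refine mul_list_prod_of_mem (fun p hp => ?_) (fun p hp q hq => ?_)
    ((List.mem_ofFn' _ _).2 ⟨j, rfl⟩)
  · obtain ⟨j, rfl⟩ := (List.mem_ofFn' _ _).1 hp
    exact isStarProjection_spectralIco (hα j) (hab j)
  · obtain ⟨i, rfl⟩ := (List.mem_ofFn' _ _).1 hp
    obtain ⟨j, rfl⟩ := (List.mem_ofFn' _ _).1 hq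
    exact commute_spectralIco_spectralIco hα hc _ _ _ _ _ _

theorem dyadic_le (k : ℤ) (m : ℕ) : (k : ℝ) / 2 ^ m ≤ ((k : ℝ) + 1) / 2 ^ m := by
  gcongr; linarith

theorem isStarProjection_of_mem_dyadicProjections (hα : ∀ j, IsSelfAdjoint (α j))
    (hc : ∀ i j, Commute (α i) (α j)) {e : H →L[ℂ] H} (he : e ∈ dyadicProjections α) :
    IsStarProjection e := by
  obtain ⟨m, k, rfl⟩ := he
  exact isStarProjection_spectralBox hα hc fun j => dyadic_le (k j) m

theorem commute_of_mem_dyadicProjections {e : H →L[ℂ] H} (he : e ∈ dyadicProjections α)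
    {y : H →L[ℂ] H} (h : ∀ j, Commute y (α j)) (h' : ∀ j, Commute (star y) (α j)) :
    Commute y e := by
  obtain ⟨m, k, rfl⟩ := he
  exact commute_spectralBox h h' _ _

theorem mem_of_mem_dyadicProjections {N : VonNeumannAlgebra H} (hN : ∀ j, α j ∈ N)
    {e : H →L[ℂ] H} (he : e ∈ dyadicProjections α) : e ∈ N :=
  mem_of_forall_commute fun _ hy => commute_of_mem_dyadicProjections he
    (fun j => commute_of_mem_commutant hy (hN j))
    fun j => commute_of_mem_commutant (star_mem hy) (hN j)

theorem commute_dyadicProjections (hα : ∀ j, IsSelfAdjoint (α j))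
    (hc : ∀ i j, Commute (α i) (α j)) {e f : H →L[ℂ] H} (he : e ∈ dyadicProjections α)
    (hf : f ∈ dyadicProjections α) : Commute e f := by
  have h : ∀ j, Commute e (α j) := fun j => (commute_of_mem_dyadicProjections he
    (fun i => hc j i) fun i => by rw [(hα j).star_eq]; exact hc j i).symm
  refine commute_of_mem_dyadicProjections hf h ?_
  rwa [(isStarProjection_of_mem_dyadicProjections hα hc he).isSelfAdjoint.star_eq]

theorem countable_dyadicProjections (α : Fin n → H →L[ℂ] H) : (dyadicProjections α).Countable := by
  have : dyadicProjections α = Set.range fun mk : ℕ × (Fin n → ℤ) =>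
      spectralBox α (fun j => (mk.2 j : ℝ) / 2 ^ mk.1)
        (fun j => ((mk.2 j : ℝ) + 1) / 2 ^ mk.1) := by
    ext e
    constructor
    · rintro ⟨m, k, rfl⟩; exact ⟨(m, k), rfl⟩
    · rintro ⟨⟨m, k⟩, rfl⟩; exact ⟨m, k, rfl⟩
  rw [this]
  exact Set.countable_range _

/-- At every dyadic level finitely many boxes form a partition of unity, and the entries of the
tuple are combinations of them up to the mesh. -/
theorem exists_dyadic_partition (hα : ∀ j, IsSelfAdjoint (α j))
    (hc : ∀ i j, Commute (α i) (α j)) (m : ℕ) :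
    ∃ (L : ℕ) (e : (Fin n → Fin L) → H →L[ℂ] H) (c : (Fin n → Fin L) → Fin n → ℝ),
      (∀ k, e k ∈ dyadicProjections α) ∧ (Pairwise fun k l => e k * e l = 0) ∧
      ∑ k, e k = 1 ∧ ∀ j, ‖α j - ∑ k, (c k j : ℂ) • e k‖ ≤ (1 / 2) ^ m := by
  obtain ⟨N, hN⟩ : ∃ N : ℕ, ∀ j, ‖α j‖ < N := by
    obtain ⟨N, hN⟩ := exists_nat_gt (∑ j, ‖α j‖)
    exact ⟨N, fun j => (Finset.single_le_sum (f := fun j => ‖α j‖)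
      (fun i _ => norm_nonneg _) (Finset.mem_univ j)).trans_lt hN⟩
  set L := 2 * (N * 2 ^ m) with hL
  -- The index `i < L` stands for the integer `i - N 2 ^ m`; these cover `[-N, N)`.
  let z : Fin L → ℤ := fun i => (i : ℤ) - N * 2 ^ m
  have hz : ∀ {i j}, i < j → z i + 1 ≤ z j := fun {i j} hij => by
    have : (i : ℕ) < j := hij
    simp only [z]; omega
  have h2 : (0 : ℝ) < 2 ^ m := by positivity
  let E : Fin n → Fin L → H →L[ℂ] H := fun j i =>
    spectralIco (α j) ((z i : ℝ) / 2 ^ m) (((z i : ℝ) + 1) / 2 ^ m)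
  let e : (Fin n → Fin L) → H →L[ℂ] H := fun k =>
    spectralBox α (fun j => (z (k j) : ℝ) / 2 ^ m) (fun j => ((z (k j) : ℝ) + 1) / 2 ^ m)
  have hle : ∀ k : Fin n → Fin L, ∀ j, (z (k j) : ℝ) / 2 ^ m ≤ ((z (k j) : ℝ) + 1) / 2 ^ m :=
    fun k j => dyadic_le _ _
  have hep : ∀ k, IsStarProjection (e k) := fun k => isStarProjection_spectralBox hα hc (hle k)
  have hEe : ∀ k j, E j (k j) * e k = e k := fun k j =>
    spectralIco_mul_spectralBox hα hc (hle k) j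
  have hEp : ∀ j i, IsStarProjection (E j i) := fun j i =>
    isStarProjection_spectralIco (hα j) (dyadic_le _ _)
  have hElt : ∀ j {i i'}, i < i' → E j i * E j i' = 0 := fun j {i i'} h =>
    spectralIco_mul_spectralIco (hα j) (dyadic_le _ _)
      (by gcongr; exact_mod_cast hz h) (dyadic_le _ _)
  have hEo : ∀ j {i i'}, i ≠ i' → E j i * E j i' = 0 := fun j {i i'} h => by
    rcases lt_or_gt_of_ne h with h | h
    · exact hElt j h
    · exact orth_symm (hEp _ _) (hEp _ _) (hElt j h)
  have heo : Pairwise fun k l => e k * e l = 0 := fun k l hkl => by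
    obtain ⟨j, hj⟩ := Function.ne_iff.1 hkl
    rw [← projSub_mul (hEp j (k j)) (hep k) (hEe k j), ← hEe l j, mul_assoc,
      ← mul_assoc (E j _), hEo j hj]
    simp
  have hEsum : ∀ j, ∑ i, E j i = 1 := fun j => by
    let f : ℕ → H →L[ℂ] H := fun i => spectralBelow (α j) (((i : ℝ) - N * 2 ^ m) / 2 ^ m)
    have h3 : ∀ i : Fin L, E j i = f (i + 1) - f i := fun i => by
      simp only [E, z, f, spectralIco]
      push_cast
      ring_nf
    simp only [h3]
    rw [Fin.sum_univ_eq_sum_range (fun i => f (i + 1) - f i), Finset.sum_range_sub]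
    have h4 : f L = 1 := by
      refine spectralBelow_eq_one (hα j) ?_
      have : (((L : ℕ) : ℝ) - N * 2 ^ m) / 2 ^ m = N := by
        rw [hL]; push_cast; field_simp; ring
      rw [this]; exact hN j
    have h5 : f 0 = spectralBelow (α j) (-N) := by
      simp only [f]
      congr 1
      push_cast
      field_simp
      ring
    rw [h4, h5, spectralBelow_eq_zero (hα j) (neg_lt_neg (hN j)), sub_zero]
  have hesum : ∑ k, e k = 1 := by
    have := sum_list_prod_ofFn E
    simp only [hEsum, List.ofFn_const, List.prod_replicate, one_pow] at this
    exact this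
  refine ⟨L, e, fun k j => (z (k j) : ℝ) / 2 ^ m, fun k => ⟨m, fun j => z (k j), rfl⟩, heo,
    hesum, fun j => ?_⟩
  have hαe : ∀ k, Commute (α j) (e k) := fun k =>
    commute_spectralBox (fun i => hc j i) (fun i => by rw [(hα j).star_eq]; exact hc j i) _ _
  have hsume : ∀ k, (∑ l, (((z (l j) : ℝ) / 2 ^ m : ℝ) : ℂ) • e l) * e k =
      (((z (k j) : ℝ) / 2 ^ m : ℝ) : ℂ) • e k := fun k => by
    rw [Finset.sum_mul, Finset.sum_eq_single k]
    · rw [smul_mul_assoc, (hep k).isIdempotentElem.eq]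
    · intro l _ hl
      rw [smul_mul_assoc, heo hl, smul_zero]
    · simp
  have hsume' : ∀ k, e k * (∑ l, (((z (l j) : ℝ) / 2 ^ m : ℝ) : ℂ) • e l) =
      (((z (k j) : ℝ) / 2 ^ m : ℝ) : ℂ) • e k := fun k => by
    rw [Finset.mul_sum, Finset.sum_eq_single k]
    · rw [mul_smul_comm, (hep k).isIdempotentElem.eq]
    · intro l _ hl
      rw [mul_smul_comm, heo hl.symm, smul_zero]
    · simp
  refine norm_le_of_partition hep hesum (fun k => (hαe k).sub_left ?_) (by positivity)
    fun k => ?_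
  · rw [Commute, SemiconjBy, hsume, hsume']
  · rw [sub_mul, hsume]
    have h3 : α j * e k - (((z (k j) : ℝ) / 2 ^ m : ℝ) : ℂ) • e k =
        (α j * E j (k j) - (((z (k j) : ℝ) / 2 ^ m : ℝ) : ℂ) • E j (k j)) * e k := by
      rw [sub_mul, smul_mul_assoc, mul_assoc, hEe]
    rw [h3]
    calc _ ≤ ‖α j * E j (k j) - (((z (k j) : ℝ) / 2 ^ m : ℝ) : ℂ) • E j (k j)‖ * ‖e k‖ :=
          norm_mul_le _ _
      _ ≤ (((z (k j) : ℝ) + 1) / 2 ^ m - (z (k j) : ℝ) / 2 ^ m) * 1 := by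
          gcongr
          · exact sub_nonneg.2 (dyadic_le _ _)
          · exact norm_mul_spectralIco_sub_le (hα j) (dyadic_le _ _)
          · exact (hep k).norm_le
      _ = (1 / 2) ^ m := by rw [one_div_pow]; ring

end Boxes

/-! ### Retractions onto the centre -/

section Retractions

/-- The operators commuting with the projections `f i` that are asymptotically equal along `f` to
an element of `C`, that is, `(a - z) * f i → 0` in norm for some `z ∈ C`. -/
def asymptoticSubalgebra (C : StarSubalgebra ℂ (H →L[ℂ] H)) (f : ℕ → H →L[ℂ] H)
    (hf : ∀ i, IsStarProjection (f i)) (hC : ∀ i, ∀ z ∈ C, Commute z (f i)) :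
    StarSubalgebra ℂ (H →L[ℂ] H) where
  carrier := {a | (∀ i, Commute a (f i)) ∧
    ∃ z ∈ C, Tendsto (fun i => (a - z) * f i) atTop (𝓝 0)}
  mul_mem' := by
    rintro a b ⟨ha, z, hz, haz⟩ ⟨hb, w, hw, hbw⟩
    refine ⟨fun i => (ha i).mul_left (hb i), z * w, mul_mem hz hw, ?_⟩
    have h1 := (hbw.const_mul a).add (haz.mul_const w)
    simp only [mul_zero, zero_mul, add_zero] at h1
    refine h1.congr fun i => ?_
    rw [mul_assoc (a - z), ← (hC i w hw).eq]
    noncomm_ring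
  add_mem' := by
    rintro a b ⟨ha, z, hz, haz⟩ ⟨hb, w, hw, hbw⟩
    refine ⟨fun i => (ha i).add_left (hb i), z + w, add_mem hz hw, ?_⟩
    have h1 := haz.add hbw
    rw [add_zero] at h1
    refine h1.congr fun i => ?_
    noncomm_ring
  algebraMap_mem' := fun r =>
    ⟨fun i => Algebra.commute_algebraMap_left r _, _, C.algebraMap_mem r, by simp⟩
  star_mem' := by
    rintro a ⟨ha, z, hz, haz⟩
    have hs : ∀ i, star (f i) = f i := fun i => (hf i).isSelfAdjoint.star_eq
    refine ⟨fun i => by have := (ha i).star_star; rwa [hs] at this, star z, star_mem hz, ?_⟩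
    have h1 := haz.star
    rw [star_zero] at h1
    refine h1.congr fun i => ?_
    rw [← star_sub, ((ha i).sub_left (hC i z hz)).eq, star_mul, hs]

variable {C : StarSubalgebra ℂ (H →L[ℂ] H)} {f : ℕ → H →L[ℂ] H}

/-- The asymptotic value has norm at most that of the element; in particular it is unique. -/
theorem norm_le_of_tendsto (hf : ∀ i, IsStarProjection (f i)) {a z : H →L[ℂ] H}
    (hz : ∀ i, ‖z‖ ≤ ‖z * f i‖) (h : Tendsto (fun i => (a - z) * f i) atTop (𝓝 0)) :
    ‖z‖ ≤ ‖a‖ := by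
  have h1 : Tendsto (fun i => ‖(a - z) * f i‖ + ‖a‖) atTop (𝓝 (0 + ‖a‖)) := by
    simpa using h.norm.add_const ‖a‖
  rw [zero_add] at h1
  refine ge_of_tendsto h1 (Eventually.of_forall fun i => (hz i).trans ?_)
  have h2 : z * f i = a * f i - (a - z) * f i := by noncomm_ring
  have h3 : ‖a * f i‖ ≤ ‖a‖ * 1 :=
    (norm_mul_le _ _).trans (mul_le_mul_of_nonneg_left (hf i).norm_le (norm_nonneg _))
  rw [h2]
  linarith [norm_sub_le (a * f i) ((a - z) * f i)]

/-- The asymptotic values of a convergent sequence form a Cauchy sequence in `C`. -/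
theorem isClosed_asymptoticSubalgebra (hCc : IsClosed (C : Set (H →L[ℂ] H)))
    (hf : ∀ i, IsStarProjection (f i)) (hC : ∀ i, ∀ z ∈ C, Commute z (f i))
    (hn : ∀ i, ∀ z ∈ C, ‖z‖ ≤ ‖z * f i‖) :
    IsClosed (asymptoticSubalgebra C f hf hC : Set (H →L[ℂ] H)) := by
  refine isClosed_of_closure_subset fun a ha => ?_
  obtain ⟨b, hb, hba⟩ := mem_closure_iff_seq_limit.1 ha
  choose hbc z hz hbz using hb
  have hdist : ∀ m n, dist (z m) (z n) ≤ dist (b m) (b n) := fun m n => by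
    rw [dist_eq_norm, dist_eq_norm]
    refine norm_le_of_tendsto hf (fun i => hn i _ (sub_mem (hz m) (hz n))) ?_
    have h1 := (hbz m).sub (hbz n)
    rw [sub_zero] at h1
    refine h1.congr fun i => ?_
    noncomm_ring
  have hcauchy : CauchySeq z := by
    rw [Metric.cauchySeq_iff]
    intro ε hε
    obtain ⟨N, hN⟩ := Metric.cauchySeq_iff.1 hba.cauchySeq ε hε
    exact ⟨N, fun m hm n hn => (hdist m n).trans_lt (hN m hm n hn)⟩
  obtain ⟨w, hw⟩ := cauchySeq_tendsto_of_complete hcauchy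
  refine ⟨fun i => ?_, w, hCc.mem_of_tendsto hw (Eventually.of_forall hz), ?_⟩
  · exact tendsto_nhds_unique (hba.mul_const (f i))
      ((hba.const_mul (f i)).congr fun n => (hbc n i).symm.eq)
  · rw [Metric.tendsto_atTop]
    intro ε hε
    obtain ⟨N₁, h1⟩ := Metric.tendsto_atTop.1 hba (ε / 3) (by positivity)
    obtain ⟨N₂, h2⟩ := Metric.tendsto_atTop.1 hw (ε / 3) (by positivity)
    set m := max N₁ N₂
    obtain ⟨N, hN⟩ := Metric.tendsto_atTop.1 (hbz m) (ε / 3) (by positivity)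
    refine ⟨N, fun i hi => ?_⟩
    have h3 := h1 m (le_max_left _ _)
    have h4 := h2 m (le_max_right _ _)
    have h5 := hN i hi
    rw [dist_eq_norm] at h3 h4
    rw [dist_zero_right] at h5 ⊢
    have hle : ∀ x : H →L[ℂ] H, ‖x * f i‖ ≤ ‖x‖ := fun x =>
      (norm_mul_le _ _).trans (mul_le_of_le_one_right (norm_nonneg _) (hf i).norm_le)
    have h6 : (a - w) * f i = (b m - z m) * f i - (b m - a) * f i + (z m - w) * f i := by
      noncomm_ring
    calc ‖(a - w) * f i‖ ≤ ‖(b m - z m) * f i‖ + ‖(b m - a) * f i‖ + ‖(z m - w) * f i‖ := by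
          rw [h6]
          exact (norm_add_le _ _).trans (add_le_add_left (norm_sub_le _ _) _)
      _ < ε := by linarith [hle (b m - a), hle (z m - w)]

/-- The asymptotic value along `f` is a `*`-homomorphism. -/
theorem exists_asymptotic_hom (hf : ∀ i, IsStarProjection (f i))
    (hC : ∀ i, ∀ z ∈ C, Commute z (f i)) (hn : ∀ i, ∀ z ∈ C, ‖z‖ ≤ ‖z * f i‖)
    {A : StarSubalgebra ℂ (H →L[ℂ] H)} (hA : A ≤ asymptoticSubalgebra C f hf hC) :
    ∃ φ : A →⋆ₐ[ℂ] C, (∀ a, ‖(φ a : H →L[ℂ] H)‖ ≤ ‖(a : H →L[ℂ] H)‖) ∧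
      ∀ (a : A) (z : H →L[ℂ] H), z ∈ C →
        Tendsto (fun i => ((a : H →L[ℂ] H) - z) * f i) atTop (𝓝 0) →
          (φ a : H →L[ℂ] H) = z := by
  choose hcom z hz hlim using fun a : A => hA a.2
  have huniq : ∀ {a z w : H →L[ℂ] H}, z ∈ C → w ∈ C →
      Tendsto (fun i => (a - z) * f i) atTop (𝓝 0) →
      Tendsto (fun i => (a - w) * f i) atTop (𝓝 0) → z = w := by
    intro a z w hz hw h1 h2
    have h3 : Tendsto (fun i => ((0 : H →L[ℂ] H) - (z - w)) * f i) atTop (𝓝 0) := by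
      have := h1.sub h2
      rw [sub_zero] at this
      refine this.congr fun i => ?_
      noncomm_ring
    have := norm_le_of_tendsto hf (fun i => hn i _ (sub_mem hz hw)) h3
    rw [norm_zero] at this
    exact sub_eq_zero.1 (norm_le_zero_iff.1 this)
  -- Each algebraic rule for the asymptotic value follows from its uniqueness.
  have hmul : ∀ a b : A, z (a * b) = z a * z b := fun a b => by
    refine huniq (hz _) (mul_mem (hz a) (hz b)) (hlim _) ?_
    have h1 := ((hlim b).const_mul (a : H →L[ℂ] H)).add ((hlim a).mul_const (z b))
    simp only [mul_zero, zero_mul, add_zero] at h1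
    refine h1.congr fun i => ?_
    rw [mul_assoc (_ - z a), ← (hC i _ (hz b)).eq]
    push_cast
    noncomm_ring
  have hadd : ∀ a b : A, z (a + b) = z a + z b := fun a b => by
    refine huniq (hz _) (add_mem (hz a) (hz b)) (hlim _) ?_
    have h1 := (hlim a).add (hlim b)
    rw [add_zero] at h1
    refine h1.congr fun i => ?_
    push_cast
    noncomm_ring
  have halg : ∀ r : ℂ, z (algebraMap ℂ A r) = algebraMap ℂ (H →L[ℂ] H) r := fun r =>
    huniq (hz _) (C.algebraMap_mem r) (hlim _) (by simp)
  have hstar : ∀ a : A, z (star a) = star (z a) := fun a => by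
    refine huniq (hz _) (star_mem (hz a)) (hlim _) ?_
    have h1 := (hlim a).star
    rw [star_zero] at h1
    refine h1.congr fun i => ?_
    rw [StarMemClass.coe_star, ← star_sub, ((hcom a i).sub_left (hC i _ (hz a))).eq, star_mul,
      (hf i).isSelfAdjoint.star_eq]
  refine ⟨{ toFun := fun a => ⟨z a, hz a⟩
            map_one' := Subtype.ext (by simpa using halg 1)
            map_mul' := fun a b => Subtype.ext (hmul a b)
            map_zero' := Subtype.ext (by simpa using halg 0)
            map_add' := fun a b => Subtype.ext (hadd a b)
            commutes' := fun r => Subtype.ext (halg r)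
            map_star' := fun a => Subtype.ext (hstar a) },
    fun a => norm_le_of_tendsto hf (fun i => hn i _ (hz a)) (hlim a),
    fun a w hw h => huniq (hz a) hw (hlim a) h⟩

variable {M : VonNeumannAlgebra H}

/-- Cutting the centre by a projection of central support `1` is isometric. -/
theorem norm_mul_of_full {e : H →L[ℂ] H} (he : e ∈ projections M)
    (hfull : ∀ z ∈ centre M, z * e = 0 → z = 0) {z : H →L[ℂ] H} (hz : z ∈ centre M) :
    ‖z * e‖ = ‖z‖ := by
  have : IsClosed (centre M : Set (H →L[ℂ] H)) := isClosed_centre M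
  let _ : CStarAlgebra (centre M) := StarSubalgebra.cstarAlgebra (centre M)
  let φ : centre M →⋆ₙₐ[ℂ] (H →L[ℂ] H) :=
    { toFun := fun z => z * e
      map_smul' := fun c z => smul_mul_assoc _ _ _
      map_zero' := zero_mul _
      map_add' := fun z w => add_mul _ _ _
      map_mul' := fun z w => by
        have h1 := (commute_of_mem_centre w.2 he.1).eq
        have h2 := he.2.isIdempotentElem.eq
        push_cast
        calc (z : H →L[ℂ] H) * w * e = z * (w * (e * e)) := by rw [h2, mul_assoc]
          _ = z * e * (w * e) := by
            rw [mul_assoc (z : H →L[ℂ] H) e, ← mul_assoc e, ← h1,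
              mul_assoc (w : H →L[ℂ] H)]
      map_star' := fun z => by
        rw [star_mul, he.2.isSelfAdjoint.star_eq, StarMemClass.coe_star]
        exact (commute_of_mem_centre (star_mem z.2) he.1).eq }
  have hinj : Function.Injective φ := by
    rw [injective_iff_map_eq_zero]
    exact fun z h => Subtype.ext (hfull z z.2 h)
  exact NonUnitalStarAlgHom.norm_map φ hinj ⟨z, hz⟩

/-- Given commuting projections `g j`, there is a sequence of projections of central support `1`
on which each `g j` is eventually equal to a central projection.  The projection `f` is replaced
by `f g + (1 - c(f g)) f`, where `g` agrees with the central support `c(f g)`. -/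
theorem exists_full_sequence {g : ℕ → H →L[ℂ] H} (hg : ∀ j, g j ∈ projections M)
    (hcomm : ∀ i j, Commute (g i) (g j)) :
    ∃ f : ℕ → H →L[ℂ] H, (∀ i, f i ∈ projections M) ∧ (∀ i j, Commute (g j) (f i)) ∧
      (∀ i, ∀ z ∈ centre M, z * f i = 0 → z = 0) ∧
      ∀ j, ∃ w ∈ centre M, (j = 0 → w = centralSupport M (g 0)) ∧
        ∀ i, j < i → (g j - w) * f i = 0 := by
  let f : ℕ → H →L[ℂ] H := fun n => Nat.rec 1
    (fun i e => e * (g i + (1 - centralSupport M (e * g i)))) n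
  have hsucc : ∀ i, f (i + 1) = f i * (g i + (1 - centralSupport M (f i * g i))) := fun i => rfl
  have hw : ∀ i, centralSupport M (f i * g i) ∈ centre M := fun i => centralSupport_mem_centre _ _
  have hwp : ∀ i, IsStarProjection (centralSupport M (f i * g i)) :=
    fun i => isStarProjection_centralSupport _ _
  have hall : ∀ i, f i ∈ projections M ∧ (∀ j, Commute (g j) (f i)) ∧
      ∀ z ∈ centre M, z * f i = 0 → z = 0 := by
    intro i
    induction i with
    | zero => exact ⟨⟨one_mem _, IsStarProjection.one _⟩, fun j => Commute.one_right _,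
        fun z _ h => by simpa [f] using h⟩
    | succ i ih =>
      obtain ⟨h1, h2, h3⟩ := ih
      set w := centralSupport M (f i * g i) with hwdef
      have hwc := hw i
      rw [← hwdef] at hwc
      have hwfg : w * (f i * g i) = f i * g i := centralSupport_mul _ _
      have hcf : Commute w (f i) := commute_of_mem_centre hwc h1.1
      have hfg : IsStarProjection (f i * g i) :=
        isStarProjection_mul h1.2 (hg i).2 (h2 i).symm
      have hwf : IsStarProjection (f i * (1 - w)) :=
        isStarProjection_mul h1.2 (hwp i).one_sub ((Commute.one_right _).sub_right hcf.symm)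
      have ho : f i * (1 - w) * (f i * g i) = 0 := by
        have : (1 - w) * (f i * g i) = 0 := by rw [sub_mul, hwfg, one_mul, sub_self]
        calc f i * (1 - w) * (f i * g i) = (1 - w) * (f i * (f i * g i)) := by
              rw [mul_sub, sub_mul, sub_mul, mul_one, ← hcf.eq]; noncomm_ring
          _ = 0 := by rw [← mul_assoc (f i), h1.2.isIdempotentElem.eq, this]
      rw [hsucc, ← hwdef]
      refine ⟨⟨mul_mem h1.1 (add_mem (hg i).1 (sub_mem (one_mem _) hwc.1)), ?_⟩,
        fun j => (h2 j).mul_right ((hcomm j i).add_right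
          ((Commute.one_right _).sub_right (commute_of_mem_centre hwc (hg j).1).symm)), ?_⟩
      · rw [mul_add]
        exact isStarProjection_add hfg hwf (orth_symm hwf hfg ho)
      · intro z hz hzf
        rw [mul_add] at hzf
        have h4 : z * (f i * g i) = 0 := by
          have := congrArg (fun x => x * (f i * g i)) hzf
          simpa only [zero_mul, mul_add, add_mul, mul_assoc z, ho, hfg.isIdempotentElem.eq,
            mul_zero, add_zero] using this
        have h5 : z * w = 0 := mul_centralSupport_eq_zero hz h4
        refine h3 z hz ?_
        rw [mul_add, h4, zero_add, mul_sub, mul_one, ← hcf.eq, mul_sub, ← mul_assoc, h5,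
          zero_mul, sub_zero] at hzf
        exact hzf
  refine ⟨f, fun i => (hall i).1, fun i => (hall i).2.1, fun i => (hall i).2.2, fun j =>
    ⟨centralSupport M (f j * g j), hw j, ?_, fun i hij => ?_⟩⟩
  · rintro rfl
    rw [show f 0 = 1 from rfl, one_mul]
  · obtain ⟨k, rfl⟩ := Nat.exists_eq_add_of_lt hij
    induction k with
    | zero =>
      rw [add_zero, hsucc]
      have h1 : centralSupport M (f j * g j) * (f j * g j) = f j * g j := centralSupport_mul _ _
      have h2 := (hall j).2.1 j
      have h3 : Commute (centralSupport M (f j * g j)) (g j) :=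
        commute_of_mem_centre (hw j) (hg j).1
      have h4 : Commute (centralSupport M (f j * g j)) (f j) :=
        commute_of_mem_centre (hw j) (hall j).1.1
      have h5 := (hwp j).isIdempotentElem.eq
      have h6 := (hg j).2.isIdempotentElem.eq
      set w := centralSupport M (f j * g j)
      have e1 : f j * g j * w = f j * g j := by
        rw [← (h4.mul_right h3).eq, h1]
      rw [sub_mul, ← mul_assoc, h2.eq, ← mul_assoc, h4.eq, mul_assoc, mul_assoc, ← mul_sub,
        ← sub_mul]
      calc f j * ((g j - w) * (g j + (1 - w)))
          = f j * (g j * g j) + f j * g j - f j * g j * w - f j * (w * g j) - f j * w +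
            f j * (w * w) := by noncomm_ring
        _ = 0 := by rw [h6, h5, h3.eq, ← mul_assoc, e1]; abel
    | succ k ih =>
      rw [show j + (k + 1) + 1 = (j + k + 1) + 1 by omega, hsucc (j + k + 1), ← mul_assoc,
        ih (by omega), zero_mul]

/-- A retraction of the C*-algebra generated by countably many commuting projections of `M` into
the centre, which carries a prescribed projection to its central support. -/
theorem exists_retraction {D : Set (H →L[ℂ] H)} (hDc : D.Countable)
    (hD : ∀ d ∈ D, d ∈ projections M) (hcomm : ∀ d ∈ D, ∀ d' ∈ D, Commute d d')
    {q : H →L[ℂ] H} (hq : q ∈ projections M) (hqD : ∀ d ∈ D, Commute q d) :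
    ∃ φ : cstarGen D →⋆ₐ[ℂ] centre M,
      (∀ a, ‖(φ a : H →L[ℂ] H)‖ ≤ ‖(a : H →L[ℂ] H)‖) ∧
      (∀ a : cstarGen D, (a : H →L[ℂ] H) ∈ centre M → (φ a : H →L[ℂ] H) = a) ∧
      ∀ a : cstarGen D, (a : H →L[ℂ] H) = q → (φ a : H →L[ℂ] H) = centralSupport M q := by
  obtain ⟨g', hg'⟩ := (hDc.insert q).exists_eq_range (Set.insert_nonempty q D)
  have hmem : ∀ i, g' i = q ∨ g' i ∈ D := fun i => by
    have : g' i ∈ insert q D := hg' ▸ Set.mem_range_self i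
    simpa using this
  obtain ⟨g, hg0, hgs⟩ : ∃ g : ℕ → H →L[ℂ] H, g 0 = q ∧ ∀ j, g (j + 1) = g' j :=
    ⟨fun n => Nat.casesOn n q g', rfl, fun _ => rfl⟩
  have hgm : ∀ j, g j = q ∨ g j ∈ D := by
    rintro (_ | j)
    exacts [Or.inl hg0, hgs j ▸ hmem j]
  have hgp : ∀ j, g j ∈ projections M := fun j => by
    rcases hgm j with h | h
    exacts [h ▸ hq, hD _ h]
  have hgc : ∀ i j, Commute (g i) (g j) := fun i j => by
    rcases hgm i with h | h <;> rcases hgm j with h' | h'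
    · rw [h, h']
    · rw [h]; exact hqD _ h'
    · rw [h']; exact (hqD _ h).symm
    · exact hcomm _ h _ h'
  obtain ⟨f, hf, hfg, hfull, hw⟩ := exists_full_sequence hgp hgc
  have hC : ∀ i, ∀ z ∈ centre M, Commute z (f i) := fun i z hz =>
    commute_of_mem_centre hz (hf i).1
  have hn : ∀ i, ∀ z ∈ centre M, ‖z‖ ≤ ‖z * f i‖ := fun i z hz =>
    (norm_mul_of_full (hf i) (hfull i) hz).ge
  have hlim : ∀ {j w}, (∀ i, j < i → (g j - w) * f i = 0) →
      Tendsto (fun i => (g j - w) * f i) atTop (𝓝 0) := fun {j w} h =>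
    tendsto_const_nhds.congr' ((eventually_gt_atTop j).mono fun i hi => (h i hi).symm)
  have hA : cstarGen D ≤ asymptoticSubalgebra (centre M) f (fun i => (hf i).2) hC := by
    refine StarSubalgebra.topologicalClosure_minimal (StarAlgebra.adjoin_le_iff.2 fun d hd => ?_)
      (isClosed_asymptoticSubalgebra (isClosed_centre M) (fun i => (hf i).2) hC hn)
    obtain ⟨j, rfl⟩ : d ∈ Set.range g' := hg' ▸ Set.mem_insert_of_mem q hd
    obtain ⟨w, hwc, -, hwj⟩ := hw (j + 1)
    rw [← hgs]
    exact ⟨fun i => hfg i (j + 1), w, hwc, hlim hwj⟩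
  obtain ⟨φ, hφ1, hφ2⟩ := exists_asymptotic_hom (fun i => (hf i).2) hC hn hA
  refine ⟨φ, hφ1, fun a ha => hφ2 a a ha (by simp), fun a ha => ?_⟩
  obtain ⟨w, hwc, hw0, hwj⟩ := hw 0
  rw [← hg0, ← hw0 rfl]
  exact hφ2 a w hwc (by rw [ha, ← hg0]; exact hlim hwj)

theorem one_le_norm_of_isStarProjection {p : H →L[ℂ] H} (hp : IsStarProjection p)
    (h : p ≠ 0) : 1 ≤ ‖p‖ := by
  have h1 : ‖p‖ ≤ ‖p‖ * ‖p‖ := by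
    conv_lhs => rw [← hp.isIdempotentElem.eq]
    exact norm_mul_le _ _
  have h2 : 0 < ‖p‖ := norm_pos_iff.2 h
  nlinarith

/-- The product of the projections `g i` or `1 - g i` selected by a list of signed indices. -/
def cellProjection (g : ℕ → H →L[ℂ] H) (l : List (ℕ × Bool)) : H →L[ℂ] H :=
  (l.map fun ib => cond ib.2 (g ib.1) (1 - g ib.1)).prod

/-- A nonzero element of the algebra generated by commuting projections `g i` is close to a
nonzero scalar on some cell: halving the cells while keeping the norm of `a`, the sequence of
cells defines a character with value of modulus at least `‖a‖`. -/
theorem exists_cellProjection {g : ℕ → H →L[ℂ] H} (hg : ∀ j, IsStarProjection (g j))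
    (hcomm : ∀ i j, Commute (g i) (g j)) {a : H →L[ℂ] H} (ha : a ∈ cstarGen (Set.range g))
    (ha0 : a ≠ 0) :
    ∃ (l : List (ℕ × Bool)) (c : ℂ), cellProjection g l ≠ 0 ∧
      ‖(a - algebraMap ℂ (H →L[ℂ] H) c) * cellProjection g l‖ < ‖c‖ := by
  set h : ℕ × Bool → H →L[ℂ] H := fun ib => cond ib.2 (g ib.1) (1 - g ib.1) with hh
  have hhp : ∀ ib, IsStarProjection (h ib) := by
    rintro ⟨i, _ | _⟩
    exacts [(hg i).one_sub, hg i]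
  have hgh : ∀ j ib, Commute (g j) (h ib) := by
    rintro j ⟨i, _ | _⟩
    exacts [(Commute.one_right _).sub_right (hcomm j i), hcomm j i]
  have hhh : ∀ ib jb, Commute (h ib) (h jb) := by
    rintro ⟨i, _ | _⟩ jb
    exacts [(Commute.one_left _).sub_left (hgh i jb), hgh i jb]
  have hcons : ∀ ib l, cellProjection g (ib :: l) = h ib * cellProjection g l := fun ib l => by
    rw [cellProjection, cellProjection, List.map_cons, List.prod_cons]
  have hlist : ∀ y : H →L[ℂ] H, (∀ ib, Commute y (h ib)) → ∀ l,
      Commute y (cellProjection g l) := fun y hy l =>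
    Commute.list_prod_right _ _ fun b hb => by
      obtain ⟨ib, -, rfl⟩ := List.mem_map.1 hb
      exact hy ib
  have hcp : ∀ l, IsStarProjection (cellProjection g l) := fun l =>
    isStarProjection_list_prod
      (fun b hb => by obtain ⟨ib, -, rfl⟩ := List.mem_map.1 hb; exact hhp ib)
      fun b hb b' hb' => by
        obtain ⟨ib, -, rfl⟩ := List.mem_map.1 hb
        obtain ⟨jb, -, rfl⟩ := List.mem_map.1 hb'
        exact hhh ib jb
  have hag : ∀ j, Commute a (g j) := by
    intro j
    have hle : cstarGen (Set.range g) ≤ StarSubalgebra.centralizer ℂ {g j} :=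
      StarSubalgebra.topologicalClosure_minimal
        (StarAlgebra.adjoin_le_iff.2 (by
          rintro _ ⟨i, rfl⟩
          rw [SetLike.mem_coe, StarSubalgebra.mem_centralizer_iff]
          rintro _ rfl
          rw [(hg j).isSelfAdjoint.star_eq]
          exact ⟨(hcomm j i).eq, (hcomm j i).eq⟩))
        (by rw [StarSubalgebra.coe_centralizer]; exact Set.isClosed_centralizer _)
    exact (((StarSubalgebra.mem_centralizer_iff ℂ).1 (hle ha) _ rfl).1).symm
  have hah : ∀ ib, Commute a (h ib) := by
    rintro ⟨i, _ | _⟩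
    exacts [(Commute.one_right _).sub_right (hag i), hag i]
  have hle1 : ∀ x b : H →L[ℂ] H, IsStarProjection b → ‖x * b‖ ≤ ‖x‖ := fun x b hb =>
    (norm_mul_le _ _).trans (mul_le_of_le_one_right (norm_nonneg _) hb.norm_le)
  have hstep : ∀ (i : ℕ) (l : {l // ‖a * cellProjection g l‖ = ‖a‖}),
      ∃ b, ‖a * cellProjection g ((i, b) :: l)‖ = ‖a‖ := by
    rintro i ⟨l, hl⟩
    by_contra hcon
    push Not at hcon
    have hlt : ∀ b, ‖a * cellProjection g l * h (i, b)‖ < ‖a‖ := fun b => by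
      have h1 : a * cellProjection g ((i, b) :: l) = a * cellProjection g l * h (i, b) := by
        rw [hcons, mul_assoc, (hlist _ (hhh (i, b)) l).eq]
      rw [← h1]
      exact lt_of_le_of_ne (hle1 _ _ (hcp _)) (hcon b)
    have h2 := norm_le_of_partition (e := fun b => h (i, b)) (T := a * cellProjection g l)
      (fun b => hhp _) (by rw [Fintype.sum_bool]; exact add_sub_cancel _ _)
      (fun b => (hah _).mul_left (hlist _ (hhh (i, b)) l).symm)
      (le_max_of_le_left (norm_nonneg (a * cellProjection g l * h (i, true))))
      (c := max ‖a * cellProjection g l * h (i, true)‖ ‖a * cellProjection g l * h (i, false)‖)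
      (by rintro (_ | _); exacts [le_max_right _ _, le_max_left _ _])
    rw [hl] at h2
    exact absurd h2 (not_le.2 (max_lt (hlt _) (hlt _)))
  choose b hb using hstep
  -- Of the two halves of a cell, one keeps the norm of `a`.
  let l : ℕ → {l // ‖a * cellProjection g l‖ = ‖a‖} := fun n =>
    Nat.rec ⟨[], by simp [cellProjection]⟩ (fun i l => ⟨(i, b i l) :: l, hb i l⟩) n
  let e : ℕ → H →L[ℂ] H := fun i => cellProjection g (l i).1
  have hesucc : ∀ i, e (i + 1) = h (i, b i (l i)) * e i := fun i => hcons _ _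
  have heq : ∀ i, ‖a * e i‖ = ‖a‖ := fun i => (l i).2
  have hne : ∀ i, e i ≠ 0 := fun i h0 => by
    have := heq i
    rw [h0, mul_zero, norm_zero] at this
    exact ha0 (norm_eq_zero.1 this.symm)
  have hval : ∀ j, ∃ c : ℂ, ∀ i, j < i → (g j - algebraMap ℂ (H →L[ℂ] H) c) * e i = 0 := by
    intro j
    have hgg := (hg j).isIdempotentElem.eq
    obtain ⟨c, hc⟩ : ∃ c : ℂ, (g j - algebraMap ℂ (H →L[ℂ] H) c) * h (j, b j (l j)) = 0 := by
      cases b j (l j)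
      · exact ⟨0, by simp [hh, mul_sub, hgg]⟩
      · exact ⟨1, by simp [hh, sub_mul, hgg]⟩
    refine ⟨c, fun i hij => ?_⟩
    obtain ⟨k, rfl⟩ := Nat.exists_eq_add_of_lt hij
    induction k with
    | zero => rw [add_zero, hesucc, ← mul_assoc, hc, zero_mul]
    | succ k ih =>
      rw [show j + (k + 1) + 1 = (j + k + 1) + 1 by omega, hesucc,
        (hlist _ (hhh _) (l (j + k + 1)).1).eq, ← mul_assoc]
      change (g j - _) * e (j + k + 1) * _ = 0
      rw [ih (by omega), zero_mul]
  have hC : ∀ i, ∀ z ∈ (⊥ : StarSubalgebra ℂ (H →L[ℂ] H)), Commute z (e i) := by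
    intro i z hz
    obtain ⟨c, rfl⟩ := StarSubalgebra.mem_bot.1 hz
    exact Algebra.commute_algebraMap_left c _
  have hn : ∀ i, ∀ z ∈ (⊥ : StarSubalgebra ℂ (H →L[ℂ] H)), ‖z‖ ≤ ‖z * e i‖ := by
    intro i z hz
    obtain ⟨c, rfl⟩ := StarSubalgebra.mem_bot.1 hz
    rw [Algebra.algebraMap_eq_smul_one, smul_mul_assoc, one_mul, norm_smul, norm_smul]
    exact mul_le_mul_of_nonneg_left ((IsStarProjection.one _).norm_le.trans
      (one_le_norm_of_isStarProjection (hcp _) (hne i))) (norm_nonneg c)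
  have hclosed : IsClosed ((⊥ : StarSubalgebra ℂ (H →L[ℂ] H)) : Set (H →L[ℂ] H)) := by
    have h1 : ((⊥ : StarSubalgebra ℂ (H →L[ℂ] H)) : Set (H →L[ℂ] H)) =
        (Submodule.span ℂ {(1 : H →L[ℂ] H)} : Set (H →L[ℂ] H)) := by
      ext z
      rw [SetLike.mem_coe, SetLike.mem_coe, StarSubalgebra.mem_bot, Submodule.mem_span_singleton]
      simp only [Set.mem_range, Algebra.algebraMap_eq_smul_one]
    rw [h1]
    exact Submodule.closed_of_finiteDimensional _
  have hA : cstarGen (Set.range g) ≤ asymptoticSubalgebra ⊥ e (fun i => hcp _) hC := by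
    refine StarSubalgebra.topologicalClosure_minimal (StarAlgebra.adjoin_le_iff.2 ?_)
      (isClosed_asymptoticSubalgebra hclosed (fun i => hcp _) hC hn)
    rintro _ ⟨j, rfl⟩
    obtain ⟨c, hc⟩ := hval j
    exact ⟨fun i => hlist _ (hgh j) _, _, (⊥ : StarSubalgebra ℂ (H →L[ℂ] H)).algebraMap_mem c,
      tendsto_const_nhds.congr' ((eventually_gt_atTop j).mono fun i hi => (hc i hi).symm)⟩
  obtain ⟨-, z, hz, hlim⟩ := hA ha
  obtain ⟨c, rfl⟩ := StarSubalgebra.mem_bot.1 hz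
  have hac : ‖a‖ ≤ ‖c‖ := by
    have h1 : Tendsto (fun i => ‖(a - algebraMap ℂ (H →L[ℂ] H) c) * e i‖ + ‖c‖) atTop
        (𝓝 (0 + ‖c‖)) := by
      simpa using hlim.norm.add_const ‖c‖
    rw [zero_add] at h1
    refine ge_of_tendsto h1 (Eventually.of_forall fun i => ?_)
    have h2 : a * e i = (a - algebraMap ℂ (H →L[ℂ] H) c) * e i + c • e i := by
      rw [sub_mul, Algebra.algebraMap_eq_smul_one, smul_mul_assoc, one_mul, sub_add_cancel]
    have h3 : ‖c • e i‖ ≤ ‖c‖ := by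
      rw [norm_smul]
      exact mul_le_of_le_one_right (norm_nonneg _) (hcp _).norm_le
    rw [← heq i, h2]
    exact (norm_add_le _ _).trans (add_le_add_right h3 _)
  have hc0 : 0 < ‖c‖ := (norm_pos_iff.2 ha0).trans_le hac
  have h1 := hlim.norm
  rw [norm_zero] at h1
  obtain ⟨i, hi⟩ := (h1.eventually_lt_const hc0).exists
  exact ⟨(l i).1, c, hne i, hi⟩

/-- The retractions attached to all cells separate the points of the algebra. -/
theorem exists_separating_retractions {D : Set (H →L[ℂ] H)} (hDc : D.Countable)
    (hDn : D.Nonempty) (hD : ∀ d ∈ D, d ∈ projections M)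
    (hcomm : ∀ d ∈ D, ∀ d' ∈ D, Commute d d') :
    ∃ ψ : ℕ → (cstarGen D →⋆ₐ[ℂ] centre M),
      (∀ k, ∀ a : cstarGen D, (a : H →L[ℂ] H) ∈ centre M → (ψ k a : H →L[ℂ] H) = a) ∧
      (∀ a, a ≠ 0 → ∃ k, ψ k a ≠ 0) ∧
      ∀ p : cstarGen D, (p : H →L[ℂ] H) ∈ D →
        ∃ k, (ψ k p : H →L[ℂ] H) = centralSupport M p := by
  obtain ⟨g, rfl⟩ := hDc.exists_eq_range hDn
  have hg : ∀ j, g j ∈ projections M := fun j => hD _ ⟨j, rfl⟩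
  have hgc : ∀ i j, Commute (g i) (g j) := fun i j => hcomm _ ⟨i, rfl⟩ _ ⟨j, rfl⟩
  have hgA : ∀ j, g j ∈ cstarGen (Set.range g) := fun j =>
    StarSubalgebra.le_topologicalClosure _ (StarAlgebra.subset_adjoin ℂ _ ⟨j, rfl⟩)
  have hsel : ∀ ib : ℕ × Bool, cond ib.2 (g ib.1) (1 - g ib.1) ∈ projections M ∧
      cond ib.2 (g ib.1) (1 - g ib.1) ∈ cstarGen (Set.range g) ∧
      ∀ j, Commute (g j) (cond ib.2 (g ib.1) (1 - g ib.1)) := by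
    rintro ⟨i, _ | _⟩
    · exact ⟨⟨sub_mem (one_mem _) (hg i).1, (hg i).2.one_sub⟩, sub_mem (one_mem _) (hgA i),
        fun j => (Commute.one_right _).sub_right (hgc j i)⟩
    · exact ⟨hg i, hgA i, fun j => hgc j i⟩
  have hcell : ∀ l, cellProjection g l ∈ projections M ∧
      cellProjection g l ∈ cstarGen (Set.range g) ∧ ∀ j, Commute (g j) (cellProjection g l) := by
    intro l
    induction l with
    | nil => exact ⟨⟨one_mem _, IsStarProjection.one _⟩, one_mem _, fun j => Commute.one_right _⟩
    | cons ib l ih =>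
      rw [cellProjection, List.map_cons, List.prod_cons]
      obtain ⟨h1, h2, h3⟩ := hsel ib
      refine ⟨⟨mul_mem h1.1 ih.1.1, isStarProjection_mul h1.2 ih.1.2 ?_⟩, mul_mem h2 ih.2.1,
        fun j => (h3 j).mul_right (ih.2.2 j)⟩
      obtain ⟨i, _ | _⟩ := ib
      exacts [(Commute.one_left _).sub_left (ih.2.2 i), ih.2.2 i]
  choose φ hφn hφc hφq using fun l => exists_retraction (M := M) (Set.countable_range g) hD hcomm
    (hcell l).1 (by rintro _ ⟨j, rfl⟩; exact ((hcell l).2.2 j).symm)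
  obtain ⟨enum, henum⟩ := exists_surjective_nat (List (ℕ × Bool))
  refine ⟨fun k => φ (enum k), fun k => hφc _, fun a ha => ?_, fun p hp => ?_⟩
  · obtain ⟨l, c, hl0, hl⟩ := exists_cellProjection (fun j => (hg j).2) hgc a.2
      fun h => ha (Subtype.ext h)
    obtain ⟨k, rfl⟩ := henum l
    refine ⟨k, fun h0 => ?_⟩
    let q : cstarGen (Set.range g) := ⟨cellProjection g (enum k), (hcell _).2.1⟩
    have h1 := hφn (enum k) ((a - algebraMap ℂ _ c) * q)
    rw [map_mul, map_sub, h0, AlgHomClass.commutes] at h1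
    have h2 : (((0 - algebraMap ℂ (centre M) c) * φ (enum k) q : centre M) : H →L[ℂ] H) =
        (-c) • centralSupport M (cellProjection g (enum k)) := by
      push_cast
      rw [hφq (enum k) q rfl, zero_sub, neg_mul, neg_smul]
      congr 1
    rw [h2, norm_smul, norm_neg] at h1
    have h3 : centralSupport M (cellProjection g (enum k)) ≠ 0 := fun h => hl0 (by
      rw [← centralSupport_mul M (cellProjection g (enum k)), h, zero_mul])
    have h4 := one_le_norm_of_isStarProjection (isStarProjection_centralSupport M _) h3
    have h5 : ‖c‖ ≤ ‖c‖ * ‖centralSupport M (cellProjection g (enum k))‖ :=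
      le_mul_of_one_le_right (norm_nonneg _) h4
    exact absurd (h5.trans h1) (not_le.2 hl)
  · obtain ⟨j, hj⟩ := hp
    obtain ⟨k, hk⟩ := henum [(j, true)]
    have h1 : (p : H →L[ℂ] H) = cellProjection g (enum k) := by
      rw [hk, ← hj]; simp [cellProjection]
    exact ⟨k, by rw [hφq (enum k) p h1, h1]⟩

end Retractions

/-! ### The homomorphism assembled from the retractions -/

section Assembly

variable {M : VonNeumannAlgebra H} {n : ℕ} {α : Fin n → H →L[ℂ] H}

theorem isClosed_dyadicAlgebra (M : VonNeumannAlgebra H) (α : Fin n → H →L[ℂ] H) :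
    IsClosed (dyadicAlgebra M α : Set (H →L[ℂ] H)) :=
  StarSubalgebra.isClosed_topologicalClosure _

theorem subset_cstarGen (S : Set (H →L[ℂ] H)) : S ⊆ cstarGen S := fun _ hs =>
  StarSubalgebra.le_topologicalClosure _ (StarAlgebra.subset_adjoin ℂ _ hs)

theorem cstarGen_le {S : Set (H →L[ℂ] H)} {B : StarSubalgebra ℂ (H →L[ℂ] H)} (h : S ⊆ B)
    (hB : IsClosed (B : Set (H →L[ℂ] H))) : cstarGen S ≤ B :=
  StarSubalgebra.topologicalClosure_minimal (StarAlgebra.adjoin_le_iff.2 h) hB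

theorem mem_dyadicAlgebra (M : VonNeumannAlgebra H) {e : H →L[ℂ] H}
    (he : e ∈ dyadicProjections α) : e ∈ dyadicAlgebra M α :=
  subset_cstarGen _ (Or.inl he)

theorem centralSupport_mem_dyadicAlgebra {e : H →L[ℂ] H} (he : e ∈ dyadicProjections α) :
    centralSupport M e ∈ dyadicAlgebra M α :=
  subset_cstarGen _ (Or.inr ⟨e, he, rfl⟩)

theorem cstarGen_dyadicCentralSupports_le (M : VonNeumannAlgebra H) (α : Fin n → H →L[ℂ] H) :
    cstarGen (dyadicCentralSupports M α) ≤ centre M :=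
  cstarGen_le (by rintro _ ⟨e, -, rfl⟩; exact centralSupport_mem_centre M e) (isClosed_centre M)

theorem isStarProjection_projSup (S : Set (H →L[ℂ] H)) : IsStarProjection (projSup S) :=
  isStarProjection_starProjection

theorem projSup_mul {S : Set (H →L[ℂ] H)} {s : H →L[ℂ] H} (hs : s ∈ S) : projSup S * s = s := by
  ext ξ
  refine Submodule.starProjection_eq_self_iff.2 (Submodule.le_topologicalClosure _ ?_)
  exact (le_iSup₂_of_le (f := fun (p : H →L[ℂ] H) (_ : p ∈ S) =>
    LinearMap.range (p : H →ₗ[ℂ] H)) s hs le_rfl) (LinearMap.mem_range_self _ ξ)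

theorem mul_projSup {S : Set (H →L[ℂ] H)} {c : H →L[ℂ] H} (h : ∀ s ∈ S, c * s = s) :
    c * projSup S = projSup S := by
  have : (1 - c) * projSup S = 0 := by
    refine mul_starProjection_closure_eq_zero fun ξ hξ => ?_
    have hle : (⨆ p ∈ S, LinearMap.range (p : H →ₗ[ℂ] H)) ≤
        LinearMap.ker ((1 - c : H →L[ℂ] H) : H →ₗ[ℂ] H) := by
      refine iSup₂_le fun s hs => ?_
      rintro _ ⟨η, rfl⟩
      have : (1 - c) * s = 0 := by rw [sub_mul, h s hs, one_mul, sub_self]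
      exact congrArg (fun T : H →L[ℂ] H => T η) this
    exact hle hξ
  rw [sub_mul, one_mul, sub_eq_zero] at this
  exact this.symm

theorem exists_isSeparatingFamily (hαM : ∀ j, α j ∈ M) (hα : ∀ j, IsSelfAdjoint (α j))
    (hc : ∀ i j, Commute (α i) (α j)) :
    ∃ ψ : ℕ → (dyadicAlgebra M α →⋆ₐ[ℂ] centre M), IsSeparatingFamily M α ψ := by
  have hG : ∀ e ∈ dyadicProjections α, e ∈ projections M := fun e he =>
    ⟨mem_of_mem_dyadicProjections hαM he, isStarProjection_of_mem_dyadicProjections hα hc he⟩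
  have hZ : ∀ e ∈ dyadicCentralSupports M α, e ∈ centralProjections M := by
    rintro _ ⟨e, -, rfl⟩
    exact ⟨centralSupport_mem_centre M e, isStarProjection_centralSupport M e⟩
  have hD : ∀ d ∈ dyadicProjections α ∪ dyadicCentralSupports M α, d ∈ projections M := by
    rintro d (hd | hd)
    exacts [hG d hd, ⟨(hZ d hd).1.1, (hZ d hd).2⟩]
  have hex : ∃ ψ : ℕ → (dyadicAlgebra M α →⋆ₐ[ℂ] centre M),
      (∀ k, ∀ a : dyadicAlgebra M α, (a : H →L[ℂ] H) ∈ centre M → (ψ k a : H →L[ℂ] H) = a) ∧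
      (∀ a, a ≠ 0 → ∃ k, ψ k a ≠ 0) ∧
      ∀ p : dyadicAlgebra M α, (p : H →L[ℂ] H) ∈ dyadicProjections α ∪ dyadicCentralSupports M α →
        ∃ k, (ψ k p : H →L[ℂ] H) = centralSupport M p := exists_separating_retractions (M := M)
    (D := dyadicProjections α ∪ dyadicCentralSupports M α)
    ((countable_dyadicProjections α).union ((countable_dyadicProjections α).image _))
    ⟨_, Or.inl ⟨0, 0, rfl⟩⟩ hD (by
      rintro d (hd | hd) d' (hd' | hd')
      · exact commute_dyadicProjections hα hc hd hd'
      · exact (commute_of_mem_centre (hZ d' hd').1 (hG d hd).1).symm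
      · exact commute_of_mem_centre (hZ d hd).1 (hG d' hd').1
      · exact commute_of_mem_centre (hZ d hd).1 (hZ d' hd').1.1)
  obtain ⟨ψ, h1, h2, h3⟩ := hex
  refine ⟨ψ, fun k b hb => h1 k b (cstarGen_dyadicCentralSupports_le M α hb), h2, fun p hp => ?_⟩
  obtain ⟨k, hk⟩ := h3 p (Or.inl hp)
  rw [(hG p hp).2.le_iff_mul_eq_right (isStarProjection_projSup _)]
  conv_lhs => rw [← centralSupport_mul M (p : H →L[ℂ] H), ← mul_assoc]
  rw [projSup_mul (S := Set.range fun k => (ψ k p : H →L[ℂ] H)) (s := centralSupport M p) ⟨k, hk⟩,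
    centralSupport_mul]

/-- The boxes are properly infinite: a central cut of a box lies in `WZ*(α)`, so it is zero as
soon as it is finite. -/
theorem isStable_of_mem_dyadicProjections (hσ : IsSigmaFinite M) (hαM : ∀ j, α j ∈ M)
    (hα : ∀ j, IsSelfAdjoint (α j)) (hc : ∀ i j, Commute (α i) (α j))
    (hfin : wzstarGen M (Set.range α) ∩ finiteProjections M = {0}) {e : H →L[ℂ] H}
    (he : e ∈ dyadicProjections α) : IsStable M e := by
  refine isStable_of_isProperlyInfinite hσ ⟨⟨mem_of_mem_dyadicProjections hαM he,
    isStarProjection_of_mem_dyadicProjections hα hc he⟩, fun z hz hne hze => hne ?_⟩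
  have : z * e ∈ wzstarGen M (Set.range α) ∩ finiteProjections M := by
    refine ⟨fun N hN => mul_mem (hN (Or.inr hz.1)) ?_, hze⟩
    exact mem_of_mem_dyadicProjections
      (fun j => hN (Or.inl fun N' hN' => hN' ⟨j, rfl⟩)) he
  rwa [hfin] at this

/-- A `*`-homomorphism out of a norm closed algebra is contractive. -/
theorem norm_hom_apply_le {A : StarSubalgebra ℂ (H →L[ℂ] H)}
    (hA : IsClosed (A : Set (H →L[ℂ] H))) {B : StarSubalgebra ℂ (H →L[ℂ] H)}
    (φ : A →⋆ₐ[ℂ] B) (a : A) : ‖(φ a : H →L[ℂ] H)‖ ≤ ‖(a : H →L[ℂ] H)‖ := by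
  have : IsClosed (A : Set (H →L[ℂ] H)) := hA
  let _ : CStarAlgebra A := StarSubalgebra.cstarAlgebra A
  exact NonUnitalStarAlgHom.norm_apply_le (B.subtype.comp φ) a

theorem isStarProjection_hom_apply {A B : StarSubalgebra ℂ (H →L[ℂ] H)} (φ : A →⋆ₐ[ℂ] B) {a : A}
    (ha : IsStarProjection (a : H →L[ℂ] H)) : IsStarProjection (φ a : H →L[ℂ] H) := by
  have h1 : a * a = a := Subtype.ext ha.isIdempotentElem.eq
  have h2 : star a = a := Subtype.ext ha.isSelfAdjoint.star_eq
  have h3 : φ a * φ a = φ a := by rw [← map_mul, h1]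
  have h4 : star (φ a) = φ a := by rw [← map_star, h2]
  exact ⟨congrArg Subtype.val h3, congrArg Subtype.val h4⟩

variable {ψk : ℕ → (dyadicAlgebra M α →⋆ₐ[ℂ] centre M)} {p : ℕ → H →L[ℂ] H}

theorem IsEquivPartition.commute (hp : IsEquivPartition M p) {z : H →L[ℂ] H}
    (hz : z ∈ centre M) (k : ℕ) : Commute z (p k) :=
  commute_of_mem_centre hz (hp.mem k).1

/-- A central element is determined by its product with a projection equivalent to `1`. -/
theorem IsEquivPartition.eq_zero_of_mul (hp : IsEquivPartition M p) {z : H →L[ℂ] H}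
    (hz : z ∈ centre M) {k : ℕ} (h : z * p k = 0) : z = 0 := by
  obtain ⟨v, hv, h1, h2, h3, -⟩ := (hp.equiv_one k).exists (hp.mem k)
    ⟨one_mem _, IsStarProjection.one _⟩
  calc z = z * (v * p k * star v) := by rw [h3, h2, mul_one]
    _ = v * (z * p k) * star v := by
        rw [← mul_assoc, ← mul_assoc, (commute_of_mem_centre hz hv).eq, mul_assoc v]
    _ = 0 := by rw [h, mul_zero, zero_mul]

/-- The diagonal homomorphism `ψ(a) = ∑ ψ_k(a) p_k`. -/
theorem exists_diagonal_hom (hp : IsEquivPartition M p) :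
    ∃ ψ : dyadicAlgebra M α →⋆ₐ[ℂ] M.toStarSubalgebra, ∀ a : dyadicAlgebra M α,
      SOTSum (fun k => (ψk k a : H →L[ℂ] H) * p k) (ψ a : H →L[ℂ] H) := by
  have hz : ∀ k a, (ψk k a : H →L[ℂ] H) ∈ centre M := fun k a => (ψk k a).2
  have hps : ∀ k, star (p k) = p k := fun k => (hp.mem k).2.isSelfAdjoint.star_eq
  have hpi : ∀ k, p k * p k = p k := fun k => (hp.mem k).2.isIdempotentElem.eq
  -- Central elements move past the projections `p k`.
  have hmul : ∀ {z w : H →L[ℂ] H}, z ∈ centre M → w ∈ centre M → ∀ k l,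
      z * p k * (w * p l) = z * w * (p k * p l) := fun {z w} _ hw k l => by
    rw [mul_assoc z, ← mul_assoc (p k), ← (hp.commute hw k).eq]
    simp only [mul_assoc]
  have hstar : ∀ {z : H →L[ℂ] H}, z ∈ centre M → ∀ k, star (z * p k) = star z * p k :=
    fun {z} hz k => by rw [star_mul, hps, (hp.commute (star_mem hz) k).eq]
  have hex : ∀ a, ∃ D, SOTSum (fun k => (ψk k a : H →L[ℂ] H) * p k) D := fun a => by
    refine exists_sotSum ‖(a : H →L[ℂ] H)‖ (fun k => ?_) (fun k l hkl => ?_) fun k l hkl => ?_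
    · exact (norm_mul_le _ _).trans ((mul_le_of_le_one_right (norm_nonneg _)
        (hp.mem k).2.norm_le).trans (norm_hom_apply_le (isClosed_dyadicAlgebra M α) (ψk k) a))
    · change star ((ψk k a : H →L[ℂ] H) * p k) * ((ψk l a : H →L[ℂ] H) * p l) = 0
      rw [hstar (hz k a), hmul (star_mem (hz k a)) (hz l a), hp.orthogonal hkl, mul_zero]
    · change (ψk k a : H →L[ℂ] H) * p k * star ((ψk l a : H →L[ℂ] H) * p l) = 0
      rw [hstar (hz l a), hmul (hz k a) (star_mem (hz l a)), hp.orthogonal hkl, mul_zero]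
  choose Ψ hΨ using hex
  have hone : SOTSum p 1 := hp.hasSum_one
  have halg : ∀ r : ℂ, Ψ (algebraMap ℂ _ r) = algebraMap ℂ (H →L[ℂ] H) r := fun r => by
    refine (hΨ _).unique ?_
    simp only [AlgHomClass.commutes]
    have := hone.mul_left (algebraMap ℂ (H →L[ℂ] H) r)
    rw [mul_one] at this
    exact this
  have hadd : ∀ a b, Ψ (a + b) = Ψ a + Ψ b := fun a b => by
    refine (hΨ _).unique ?_
    have h2 : ∀ k, (ψk k a : H →L[ℂ] H) * p k + (ψk k b : H →L[ℂ] H) * p k =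
        (ψk k (a + b) : H →L[ℂ] H) * p k := fun k => by
      rw [map_add, ← add_mul]
      rfl
    simpa only [h2] using (hΨ a).add (hΨ b)
  have hmul' : ∀ a b, Ψ (a * b) = Ψ a * Ψ b := fun a b => by
    refine (hΨ _).unique ?_
    have h1 := (hΨ b).mul_left (Ψ a)
    have h2 : ∀ k, Ψ a * ((ψk k b : H →L[ℂ] H) * p k) = (ψk k (a * b) : H →L[ℂ] H) * p k :=
      fun k => by
        rw [(hΨ a).mul_eq_of_orthogonal k fun l hl => by
          rw [hmul (hz l a) (hz k b), hp.orthogonal hl, mul_zero],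
          hmul (hz k a) (hz k b), hpi, map_mul]
        rfl
    simpa only [h2] using h1
  have hstar' : ∀ a, Ψ (star a) = star (Ψ a) := fun a => by
    refine ((hΨ a).star_eq ?_).symm
    have h2 : ∀ k, star ((ψk k a : H →L[ℂ] H) * p k) =
        (ψk k (star a) : H →L[ℂ] H) * p k := fun k => by
      rw [hstar (hz k a), map_star]
      rfl
    simpa only [h2] using hΨ (star a)
  have hΨM : ∀ a, Ψ a ∈ M := fun a =>
    (hΨ a).mem fun k => mul_mem (hz k a).1 (hp.mem k).1
  exact ⟨{  toFun := fun a => ⟨Ψ a, hΨM a⟩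
            map_one' := Subtype.ext (by simpa using halg 1)
            map_mul' := fun a b => Subtype.ext (hmul' a b)
            map_zero' := Subtype.ext (by simpa using halg 0)
            map_add' := fun a b => Subtype.ext (hadd a b)
            commutes' := fun r => Subtype.ext (halg r)
            map_star' := fun a => Subtype.ext (hstar' a) }, hΨ⟩

variable {ψ : dyadicAlgebra M α →⋆ₐ[ℂ] M.toStarSubalgebra}

theorem mul_eq_of_diagonal (hp : IsEquivPartition M p) {a : dyadicAlgebra M α}
    (hψ : SOTSum (fun k => (ψk k a : H →L[ℂ] H) * p k) (ψ a : H →L[ℂ] H)) (k : ℕ) :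
    (ψ a : H →L[ℂ] H) * p k = (ψk k a : H →L[ℂ] H) * p k := by
  rw [hψ.mul_eq_of_orthogonal k fun l hl => by rw [mul_assoc, hp.orthogonal hl, mul_zero],
    mul_assoc, (hp.mem k).2.isIdempotentElem.eq]

theorem injective_diagonal (hp : IsEquivPartition M p) (hs : IsSeparatingFamily M α ψk)
    (hψ : ∀ a : dyadicAlgebra M α,
      SOTSum (fun k => (ψk k a : H →L[ℂ] H) * p k) (ψ a : H →L[ℂ] H)) :
    Function.Injective ψ := by
  rw [injective_iff_map_eq_zero]
  intro a ha
  by_contra hne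
  obtain ⟨k, hk⟩ := hs.separating a hne
  refine hk (Subtype.ext (hp.eq_zero_of_mul (ψk k a).2 (k := k) ?_))
  rw [← mul_eq_of_diagonal hp (hψ a), ha]
  exact zero_mul _

/-- Every box is equivalent to its image: both are stable, with the same central support. -/
theorem mvnEquiv_diagonal (hM : IsProperlyInfinite M) (hσ : IsSigmaFinite M)
    (hαM : ∀ j, α j ∈ M) (hα : ∀ j, IsSelfAdjoint (α j)) (hc : ∀ i j, Commute (α i) (α j))
    (hfin : wzstarGen M (Set.range α) ∩ finiteProjections M = {0})
    (hp : IsEquivPartition M p) (hs : IsSeparatingFamily M α ψk)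
    (hψ : ∀ a : dyadicAlgebra M α,
      SOTSum (fun k => (ψk k a : H →L[ℂ] H) * p k) (ψ a : H →L[ℂ] H))
    {e : H →L[ℂ] H} (he : e ∈ dyadicProjections α) :
    (ψ ⟨e, mem_dyadicAlgebra M he⟩ : H →L[ℂ] H) ∈ projections M ∧
      MvNEquiv M (ψ ⟨e, mem_dyadicAlgebra M he⟩ : H →L[ℂ] H) e := by
  have hep : e ∈ projections M :=
    ⟨mem_of_mem_dyadicProjections hαM he, isStarProjection_of_mem_dyadicProjections hα hc he⟩
  set a : dyadicAlgebra M α := ⟨e, mem_dyadicAlgebra M he⟩ with ha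
  have hQ : (ψ a : H →L[ℂ] H) ∈ projections M := ⟨(ψ a).2, isStarProjection_hom_apply ψ hep.2⟩
  have hz : ∀ k, (ψk k a : H →L[ℂ] H) ∈ centralProjections M := fun k =>
    ⟨(ψk k a).2, isStarProjection_hom_apply (ψk k) hep.2⟩
  have h1 : IsStable M 1 := isStable_of_isProperlyInfinite hσ hM
  have h1p : (1 : H →L[ℂ] H) ∈ projections M := ⟨one_mem _, IsStarProjection.one _⟩
  have hQst : IsStable M (ψ a : H →L[ℂ] H) := by
    refine IsStable.sum (fun k => central_mul_mem_projections (hz k) (hp.mem k))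
      (fun k l hkl => ?_) (hψ a) fun k =>
        (h1.of_equiv h1p (hp.mem k) (hp.equiv_one k).symm).central_mul (hz k)
    change (ψk k a : H →L[ℂ] H) * p k * ((ψk l a : H →L[ℂ] H) * p l) = 0
    rw [(hp.commute (hz l).1 l).eq, mul_assoc, ← mul_assoc (p k), hp.orthogonal hkl, zero_mul,
      mul_zero]
  have hest : IsStable M e := isStable_of_mem_dyadicProjections hσ hαM hα hc hfin he
  refine ⟨hQ, mvnEquiv_of_isStable hσ hQ hep hQst hest ?_ ?_⟩
  · -- `ψ_k(e) ≤ ψ_k(c(e)) = c(e)` for all `k`.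
    have h2 : ∀ k, centralSupport M e * (ψk k a : H →L[ℂ] H) = ψk k a := fun k => by
      set c : dyadicAlgebra M α := ⟨centralSupport M e, centralSupport_mem_dyadicAlgebra he⟩
        with hcdef
      have h3 : (ψk k c : H →L[ℂ] H) = centralSupport M e :=
        hs.eq_self k c (subset_cstarGen _ ⟨e, he, rfl⟩)
      have h4 : c * a = a := Subtype.ext (centralSupport_mul M e)
      have h5 := congrArg (fun x => (ψk k x : H →L[ℂ] H)) h4
      simp only [map_mul] at h5
      rw [← h3]
      exact h5
    have h6 : centralSupport M e * (ψ a : H →L[ℂ] H) = ψ a := by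
      refine ((hψ a).mul_left _).unique ?_
      simpa only [← mul_assoc, h2] using hψ a
    rw [← (commute_of_mem_centre (centralSupport_mem_centre M e) hQ.1).eq, h6]
  · set c := centralSupport M (ψ a : H →L[ℂ] H) with hcdef
    have hcc : c ∈ centre M := centralSupport_mem_centre M _
    have h2 : ∀ k, c * (ψk k a : H →L[ℂ] H) = ψk k a := fun k => by
      have h3 : (c * (ψk k a : H →L[ℂ] H) - ψk k a) * p k = 0 := by
        rw [sub_mul, mul_assoc, ← mul_eq_of_diagonal hp (hψ a), ← mul_assoc, hcdef,
          centralSupport_mul, sub_self]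
      exact sub_eq_zero.1 (hp.eq_zero_of_mul (sub_mem (mul_mem hcc (hz k).1) (hz k).1) h3)
    have h4 := mul_projSup (S := Set.range fun k => (ψk k a : H →L[ℂ] H)) (c := c)
      (by rintro _ ⟨k, rfl⟩; exact h2 k)
    have h5 := (hep.2.le_iff_mul_eq_right (isStarProjection_projSup _)).1 (hs.le_sup a he)
    rw [← (commute_of_mem_centre hcc hep.1).eq, ← h5, ← mul_assoc, h4]

/-- A unitary of `M` that intertwines a finite partition of unity by boxes with its image. -/
theorem exists_intertwining_unitary (hM : IsProperlyInfinite M) (hσ : IsSigmaFinite M)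
    (hαM : ∀ j, α j ∈ M) (hα : ∀ j, IsSelfAdjoint (α j)) (hc : ∀ i j, Commute (α i) (α j))
    (hfin : wzstarGen M (Set.range α) ∩ finiteProjections M = {0})
    (hp : IsEquivPartition M p) (hs : IsSeparatingFamily M α ψk)
    (hψ : ∀ a : dyadicAlgebra M α,
      SOTSum (fun k => (ψk k a : H →L[ℂ] H) * p k) (ψ a : H →L[ℂ] H))
    {κ : Type*} [Fintype κ] {e : κ → H →L[ℂ] H} (he : ∀ k, e k ∈ dyadicProjections α)
    (ho : Pairwise fun k l => e k * e l = 0) (hsum : ∑ k, e k = 1) :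
    ∃ u : unitary (H →L[ℂ] H), (u : H →L[ℂ] H) ∈ M ∧
      ∀ k, e k * u = u * (ψ ⟨e k, mem_dyadicAlgebra M (he k)⟩ : H →L[ℂ] H) := by
  have hep : ∀ k, e k ∈ projections M := fun k => ⟨mem_of_mem_dyadicProjections hαM (he k),
    isStarProjection_of_mem_dyadicProjections hα hc (he k)⟩
  have hequiv := fun k => mvnEquiv_diagonal hM hσ hαM hα hc hfin hp hs hψ (he k)
  have hP := SOTSum.of_finset fun k => (ψ ⟨e k, mem_dyadicAlgebra M (he k)⟩ : H →L[ℂ] H)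
  have hQ := SOTSum.of_finset e
  have hPsum : ∑ k, (ψ ⟨e k, mem_dyadicAlgebra M (he k)⟩ : H →L[ℂ] H) = 1 := by
    have h1 : ∑ k, (⟨e k, mem_dyadicAlgebra M (he k)⟩ : dyadicAlgebra M α) = 1 :=
      Subtype.ext (by push_cast; exact hsum)
    have h2 := congrArg (fun x => (ψ x : H →L[ℂ] H)) h1
    simp only [map_sum, map_one] at h2
    push_cast at h2
    exact h2
  rw [hPsum] at hP
  rw [hsum] at hQ
  obtain ⟨V, hV, h1, h2, h3⟩ := MvNEquiv.sum (fun k => (hequiv k).1) hep (fun k l hkl => by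
    have h4 : (⟨e k, mem_dyadicAlgebra M (he k)⟩ : dyadicAlgebra M α) *
        ⟨e l, mem_dyadicAlgebra M (he l)⟩ = 0 := Subtype.ext (ho hkl)
    have h5 := congrArg (fun x => (ψ x : H →L[ℂ] H)) h4
    simp only [map_mul, map_zero] at h5
    exact h5) ho hP hQ fun k => (hequiv k).2
  exact ⟨⟨V, Unitary.mem_iff.2 ⟨h1, h2⟩⟩, hV, h3⟩

theorem norm_unitary_conj (u : unitary (H →L[ℂ] H)) (x : H →L[ℂ] H) :
    ‖((u⁻¹ : unitary (H →L[ℂ] H)) : H →L[ℂ] H) * x * u‖ = ‖x‖ := by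
  rw [CStarRing.norm_mul_coe_unitary, CStarRing.norm_coe_unitary_mul]

theorem unitary_mul_inv (u : unitary (H →L[ℂ] H)) :
    (u : H →L[ℂ] H) * (u⁻¹ : unitary (H →L[ℂ] H)) = 1 := by
  rw [← Submonoid.coe_mul, mul_inv_cancel]; rfl

theorem unitary_inv_mul (u : unitary (H →L[ℂ] H)) :
    ((u⁻¹ : unitary (H →L[ℂ] H)) : H →L[ℂ] H) * u = 1 := by
  rw [← Submonoid.coe_mul, inv_mul_cancel]; rfl

/-- The elements on which conjugation by a sequence of unitaries converges to a given
homomorphism. -/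
def conjLimitSubalgebra {A B : StarSubalgebra ℂ (H →L[ℂ] H)} (φ : A →⋆ₐ[ℂ] B)
    (u : ℕ → unitary (H →L[ℂ] H)) : StarSubalgebra ℂ (H →L[ℂ] H) where
  carrier := {s | ∃ h : s ∈ A, Tendsto
    (fun m => ((u m)⁻¹ : unitary (H →L[ℂ] H)) * s * (u m : H →L[ℂ] H)) atTop
    (𝓝 (φ ⟨s, h⟩ : H →L[ℂ] H))}
  mul_mem' := by
    rintro a b ⟨ha, hau⟩ ⟨hb, hbu⟩
    refine ⟨mul_mem ha hb, ?_⟩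
    have h1 : (φ ⟨a * b, mul_mem ha hb⟩ : H →L[ℂ] H) = φ ⟨a, ha⟩ * φ ⟨b, hb⟩ :=
      congrArg Subtype.val (map_mul φ ⟨a, ha⟩ ⟨b, hb⟩)
    rw [h1]
    refine (hau.mul hbu).congr fun m => ?_
    calc _ = ((u m)⁻¹ : unitary (H →L[ℂ] H)) * a *
          ((u m : H →L[ℂ] H) * ((u m)⁻¹ : unitary (H →L[ℂ] H))) * b *
          (u m : H →L[ℂ] H) := by simp only [mul_assoc]
      _ = _ := by rw [unitary_mul_inv, mul_one]; simp only [mul_assoc]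
  add_mem' := by
    rintro a b ⟨ha, hau⟩ ⟨hb, hbu⟩
    refine ⟨add_mem ha hb, ?_⟩
    have h1 : (φ ⟨a + b, add_mem ha hb⟩ : H →L[ℂ] H) = φ ⟨a, ha⟩ + φ ⟨b, hb⟩ :=
      congrArg Subtype.val (map_add φ ⟨a, ha⟩ ⟨b, hb⟩)
    rw [h1]
    refine (hau.add hbu).congr fun m => ?_
    rw [mul_add, add_mul]
  algebraMap_mem' := fun r => by
    refine ⟨A.algebraMap_mem r, ?_⟩
    have h1 : (φ ⟨algebraMap ℂ _ r, A.algebraMap_mem r⟩ : H →L[ℂ] H) =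
        algebraMap ℂ (H →L[ℂ] H) r := congrArg Subtype.val (AlgHomClass.commutes φ r)
    rw [h1]
    refine tendsto_const_nhds.congr fun m => ?_
    rw [← (Algebra.commute_algebraMap_left r _).eq, mul_assoc, unitary_inv_mul, mul_one]
  star_mem' := by
    rintro a ⟨ha, hau⟩
    have hsa : star a ∈ A := star_mem ha
    refine ⟨hsa, ?_⟩
    have h1 : (φ ⟨star a, hsa⟩ : H →L[ℂ] H) = star (φ ⟨a, ha⟩ : H →L[ℂ] H) := by
      have h0 : (⟨star a, hsa⟩ : A) = star ⟨a, ha⟩ := rfl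
      rw [h0, map_star, StarMemClass.coe_star]
    rw [h1]
    refine hau.star.congr fun m => ?_
    have h2 : star (((u m)⁻¹ : unitary (H →L[ℂ] H)) : H →L[ℂ] H) = u m := by
      rw [← Unitary.coe_star, ← Unitary.star_eq_inv, star_star]
    have h3 : star (u m : H →L[ℂ] H) = ((u m)⁻¹ : unitary (H →L[ℂ] H)) := by
      rw [← Unitary.coe_star, Unitary.star_eq_inv]
    rw [star_mul, star_mul, h2, h3, mul_assoc]

theorem isClosed_conjLimitSubalgebra {A B : StarSubalgebra ℂ (H →L[ℂ] H)}
    (hA : IsClosed (A : Set (H →L[ℂ] H))) (φ : A →⋆ₐ[ℂ] B) (u : ℕ → unitary (H →L[ℂ] H)) :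
    IsClosed (conjLimitSubalgebra φ u : Set (H →L[ℂ] H)) := by
  refine isClosed_of_closure_subset fun a ha => ?_
  have haA : a ∈ A := hA.closure_subset (closure_mono (fun s hs => hs.1) ha)
  refine ⟨haA, Metric.tendsto_atTop.2 fun ε hε => ?_⟩
  obtain ⟨b, ⟨hbA, hb⟩, hab⟩ := Metric.mem_closure_iff.1 ha (ε / 3) (by positivity)
  obtain ⟨N, hN⟩ := Metric.tendsto_atTop.1 hb (ε / 3) (by positivity)
  refine ⟨N, fun m hm => ?_⟩
  have h1 := hN m hm
  rw [dist_eq_norm] at h1 hab ⊢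
  have h2 : ‖((φ ⟨b, hbA⟩ : B) : H →L[ℂ] H) - φ ⟨a, haA⟩‖ ≤ ‖a - b‖ := by
    have := norm_hom_apply_le hA φ (⟨b, hbA⟩ - ⟨a, haA⟩)
    rw [map_sub] at this
    rw [norm_sub_rev a b]
    exact this
  have h3 : ((u m)⁻¹ : unitary (H →L[ℂ] H)) * a * (u m : H →L[ℂ] H) - φ ⟨a, haA⟩ =
      ((u m)⁻¹ : unitary (H →L[ℂ] H)) * (a - b) * (u m : H →L[ℂ] H) +
      (((u m)⁻¹ : unitary (H →L[ℂ] H)) * b * (u m : H →L[ℂ] H) - φ ⟨b, hbA⟩) +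
      (((φ ⟨b, hbA⟩ : B) : H →L[ℂ] H) - φ ⟨a, haA⟩) := by
    rw [mul_sub, sub_mul]; abel
  rw [h3]
  refine (norm_add₃_le).trans_lt ?_
  rw [norm_unitary_conj]
  linarith

theorem cstarGen_le_dyadicAlgebra (hα : ∀ j, IsSelfAdjoint (α j))
    (hc : ∀ i j, Commute (α i) (α j)) : cstarGen (Set.range α) ≤ dyadicAlgebra M α := by
  refine cstarGen_le ?_ (isClosed_dyadicAlgebra M α)
  rintro _ ⟨j, rfl⟩
  refine (isClosed_dyadicAlgebra M α).closure_subset (Metric.mem_closure_iff.2 fun ε hε => ?_)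
  obtain ⟨m, hm⟩ := exists_pow_lt_of_lt_one hε (by norm_num : (1 / 2 : ℝ) < 1)
  obtain ⟨L, e, c, he, -, -, hαe⟩ := exists_dyadic_partition hα hc m
  refine ⟨_, sum_mem fun k (_ : k ∈ Finset.univ) =>
    (dyadicAlgebra M α).smul_mem (mem_dyadicAlgebra M (he k)) (c k j : ℂ), ?_⟩
  rw [dist_eq_norm]
  exact (hαe j).trans_lt hm

/-- The unitaries intertwining the boxes of level `m` conjugate each `α j` to within `2 · 2⁻ᵐ` of
its image. -/
theorem approxEquiv_diagonal (hM : IsProperlyInfinite M) (hσ : IsSigmaFinite M)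
    (hαM : ∀ j, α j ∈ M) (hα : ∀ j, IsSelfAdjoint (α j)) (hc : ∀ i j, Commute (α i) (α j))
    (hfin : wzstarGen M (Set.range α) ∩ finiteProjections M = {0})
    (hp : IsEquivPartition M p) (hs : IsSeparatingFamily M α ψk)
    (hψ : ∀ a : dyadicAlgebra M α,
      SOTSum (fun k => (ψk k a : H →L[ℂ] H) * p k) (ψ a : H →L[ℂ] H))
    (hA : cstarGen (Set.range α) ≤ dyadicAlgebra M α)
    (hαC : cstarGen (Set.range α) ≤ M.toStarSubalgebra) :
    ApproxEquiv M (ψ.comp (StarSubalgebra.inclusion hA)) (StarSubalgebra.inclusion hαC) := by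
  choose L e c he ho hsum hαe using exists_dyadic_partition hα hc
  choose u huM hu using fun m =>
    exists_intertwining_unitary hM hσ hαM hα hc hfin hp hs hψ (he m) (ho m) (hsum m)
  refine ⟨u, huM, fun b => ?_⟩
  suffices h : Set.range α ⊆ conjLimitSubalgebra ψ u from
    (cstarGen_le h (isClosed_conjLimitSubalgebra (isClosed_dyadicAlgebra M α) ψ u) b.2).2
  rintro _ ⟨j, rfl⟩
  have hjA : α j ∈ dyadicAlgebra M α := hA (subset_cstarGen _ ⟨j, rfl⟩)
  refine ⟨hjA, ?_⟩
  rw [tendsto_iff_norm_sub_tendsto_zero]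
  have hlim : Tendsto (fun m : ℕ => 2 * (1 / 2 : ℝ) ^ m) atTop (𝓝 0) := by
    simpa using (tendsto_pow_atTop_nhds_zero_of_lt_one (by norm_num : (0 : ℝ) ≤ 1 / 2)
      (by norm_num)).const_mul 2
  refine squeeze_zero (fun _ => norm_nonneg _) (fun m => ?_) hlim
  set s : dyadicAlgebra M α := ∑ k, (c m k j : ℂ) • ⟨e m k, mem_dyadicAlgebra M (he m k)⟩ with hs'
  have hsc : (s : H →L[ℂ] H) = ∑ k, (c m k j : ℂ) • e m k := by
    rw [hs']; push_cast; rfl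
  have hψs : (ψ s : H →L[ℂ] H) =
      ∑ k, (c m k j : ℂ) • (ψ ⟨e m k, mem_dyadicAlgebra M (he m k)⟩ : H →L[ℂ] H) := by
    rw [hs', map_sum]; push_cast; simp only [map_smul]; rfl
  have hsu : (s : H →L[ℂ] H) * u m = u m * (ψ s : H →L[ℂ] H) := by
    rw [hsc, hψs, Finset.sum_mul, Finset.mul_sum]
    refine Finset.sum_congr rfl fun k _ => ?_
    rw [smul_mul_assoc, mul_smul_comm, hu]
  have hconj : ((u m)⁻¹ : unitary (H →L[ℂ] H)) * (s : H →L[ℂ] H) * (u m : H →L[ℂ] H) = ψ s := by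
    rw [mul_assoc, hsu, ← mul_assoc, unitary_inv_mul, one_mul]
  have h1 : ((u m)⁻¹ : unitary (H →L[ℂ] H)) * α j * (u m : H →L[ℂ] H) - ψ ⟨α j, hjA⟩ =
      ((u m)⁻¹ : unitary (H →L[ℂ] H)) * (α j - s) * (u m : H →L[ℂ] H) -
        (ψ (⟨α j, hjA⟩ - s) : H →L[ℂ] H) := by
    rw [mul_sub, sub_mul, hconj, map_sub]
    push_cast
    abel
  have h2 : ‖α j - (s : H →L[ℂ] H)‖ ≤ (1 / 2) ^ m := by rw [hsc]; exact hαe m j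
  have h3 := norm_hom_apply_le (isClosed_dyadicAlgebra M α) ψ (⟨α j, hjA⟩ - s)
  rw [h1]
  refine (norm_sub_le _ _).trans ?_
  rw [norm_unitary_conj]
  have h4 : ‖((⟨α j, hjA⟩ - s : dyadicAlgebra M α) : H →L[ℂ] H)‖ ≤ (1 / 2) ^ m := h2
  linarith

end Assembly

end VNApprox

end

theorem mainTheorem3 {H : Type*} [NormedAddCommGroup H] [InnerProductSpace ℂ H] [CompleteSpace H]
    (M : VonNeumannAlgebra H) (hM : VNApprox.IsProperlyInfinite M)
    (hσ : VNApprox.IsSigmaFinite M)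
    {n : ℕ} (α : Fin n → H →L[ℂ] H) (hαM : ∀ j, α j ∈ M) (hαsa : ∀ j, IsSelfAdjoint (α j))
    (hαcomm : ∀ i j, Commute (α i) (α j))
    (hfin : VNApprox.wzstarGen M (Set.range α) ∩ VNApprox.finiteProjections M = {0}) :
    (∃ ψ : ℕ → (VNApprox.dyadicAlgebra M α →⋆ₐ[ℂ] VNApprox.centre M),
      VNApprox.IsSeparatingFamily M α ψ) ∧
    (∃ p : ℕ → H →L[ℂ] H, VNApprox.IsEquivPartition M p) ∧
    ∀ (ψk : ℕ → (VNApprox.dyadicAlgebra M α →⋆ₐ[ℂ] VNApprox.centre M)) (p : ℕ → H →L[ℂ] H),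
      VNApprox.IsSeparatingFamily M α ψk → VNApprox.IsEquivPartition M p →
      ∃ ψ : VNApprox.dyadicAlgebra M α →⋆ₐ[ℂ] M.toStarSubalgebra,
        (∀ (a : VNApprox.dyadicAlgebra M α) (x : H),
          HasSum (fun k => ((ψk k a : H →L[ℂ] H) * p k) x) ((ψ a : H →L[ℂ] H) x)) ∧
        Function.Injective ψ ∧
        ∃ (hA : VNApprox.cstarGen (Set.range α) ≤ VNApprox.dyadicAlgebra M α)
          (hαC : VNApprox.cstarGen (Set.range α) ≤ M.toStarSubalgebra),
          VNApprox.ApproxEquiv M (ψ.comp (StarSubalgebra.inclusion hA))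
            (StarSubalgebra.inclusion hαC) := by
  refine ⟨VNApprox.exists_isSeparatingFamily hαM hαsa hαcomm, VNApprox.exists_isEquivPartition
    (VNApprox.isStable_of_isProperlyInfinite hσ hM), fun ψk p hs hp => ?_⟩
  obtain ⟨ψ, hψ⟩ := VNApprox.exists_diagonal_hom (ψk := ψk) hp
  have hA : VNApprox.cstarGen (Set.range α) ≤ VNApprox.dyadicAlgebra M α :=
    VNApprox.cstarGen_le_dyadicAlgebra hαsa hαcomm
  have hαC : VNApprox.cstarGen (Set.range α) ≤ M.toStarSubalgebra :=
    VNApprox.cstarGen_le (by rintro _ ⟨j, rfl⟩; exact hαM j)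
      (VNApprox.isClosed_vonNeumannAlgebra M)
  exact ⟨ψ, hψ, VNApprox.injective_diagonal hp hs hψ, hA, hαC,
    VNApprox.approxEquiv_diagonal hM hσ hαM hαsa hαcomm hfin hp hs hψ hA hαC⟩
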